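/- **Theorem 4.10.** Let $k$ be a field of characteristic $3$, and let $V$ be a two-dimensional $k$-vector space with a nonzero alternating bilinear form $\langle\cdot|\cdot\rangle$. Let $f\mapsto\bar f$ be the involution of $\mathrm{End}_k(V)$ with $\langle f(u)|v\rangle=\langle u|\bar f(v)\rangle$. Let $B(4,2)$ be the superalgebra with even part $\mathrm{End}_k(V)$ and odd part $V$, with composition of maps on $\mathrm{End}_k(V)$ and $$v\cdot f=f(v)=\bar f\cdot v,\qquad u\cdot v=\bigl(w\mapsto\langle w|u\rangle v\bigr)\in\mathrm{End}_k(V)\qquad(f\in \mathrm{End}_k(V),\ u,v\in V).$$ Let $\mathrm b$ be the even bilinear form on $B(4,2)$ with $\mathrm b(f,g)=\det(f+g)-\det f-\det g$ and $\mathrm b(u,v)=\langle u|v\rangle$, and put $T=B(4,2)^0=\{x:\mathrm b(1,x)=0\}$. For homogeneous elements write $[x,y]=xy-(-1)^{xy}yx$, where a letter in an exponent stands for the parity of the element. An *orthosymplectic triple system* is a superspace $T$ with a nonzero even bilinear form $(\cdot|\cdot)$, symmetric on $T_{\bar0}$ and alternating on $T_{\bar1}$, and an even trilinear product $[xyz]$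 such that for all homogeneous elements $$[xyz]+(-1)^{xy}[yxz]=0,\qquad [xyz]+(-1)^{yz}[xzy]=(x|y)z+(-1)^{yz}(x|z)y-2(y|z)x,$$ $$[xy[uvw]]=[[xyu]vw]+(-1)^{(x+y)u}[u[xyv]w]+(-1)^{(x+y)(u+v)}[uv[xyw]],$$ $$([xyu]|v)+(-1)^{(x+y)u}(u|[xyv])=0 .$$ Let $d_{x,y}=[xy\,\cdot\,]$ and let $\mathrm{inder}(T)$ be the span of all $d_{x,y}$, with the supercommutator as bracket. Given a two-dimensional space $W$ with a nonzero alternating form $\langle\cdot|\cdot\rangle$, considered as an odd space, let $$\mathfrak g(T)=\bigl(\mathfrak{sp}(W)\oplus\mathrm{inder}(T)\bigr)\oplus(W\otimes T)$$ be the superalgebra with superanticommutative product that is the bracket of the direct sum on $\mathfrak{sp}(W)\oplus\mathrm{inder}(T)$, with $[s,w\otimes x]=s(w)\otimes x$, $[d,w\otimes x]=(-1)^{d}w\otimes d(x)$ and $$[u\otimes x,w\otimes y]=(-1)^x\bigl(-(x|y)\gamma_{u,w}+\langle u|w\rangle d_{x,y}\bigr),\qquad \gamma_{u,w}=\langle u|\cdot\rangle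 w+\langle w|\cdot\rangle u .$$ Let $\mathfrak{br}(2;3)$ be the Lie superalgebra over $k$ with Cartan matrix $A=\begin{pmatrix}0&-1\\-2&1\end{pmatrix}$ and both simple roots odd: it is $\tilde{\mathfrak g}/\mathfrak r$, where $\tilde{\mathfrak g}$ is the Lie superalgebra generated by odd elements $e_1,e_2,f_1,f_2$ and even elements $h_1,h_2$ subject to $[h_i,h_j]=0$, $[h_i,e_j]=a_{ij}e_j$, $[h_i,f_j]=-a_{ij}f_j$, $[e_i,f_j]=\delta_{ij}h_i$, graded over $\mathbb Z^2$ by $\deg e_i=-\deg f_i=\alpha_i$ (the canonical basis) and $\deg h_i=0$, and $\mathfrak r$ is the largest $\mathbb Z^2$-graded ideal of $\tilde{\mathfrak g}$ that intersects $\mathrm{span}(h_1,h_2)$ trivially. (In characteristic $3$ a Lie superalgebra is required to satisfy also $[x,[x,x]]=0$ for odd $x$.) Then, with $[xyz]=[[x,y],z]$ and $(x|y)=2\,\mathrm b(x,y)$, $T=B(4,2)^0$ is an orthosymplectic triple system with $\dim T_{\bar0}=3$ and $\dim T_{\bar1}=2$; the superalgebra $\mathfrak g(T)$ is a Lie superalgebra;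 and $\mathfrak g(T)$ is isomorphic to $\mathfrak{br}(2;3)$. -/

import Mathlib

open scoped TensorProduct

noncomputable section

namespace SuperTriple

universe u v w

/-! ## Superspaces, superalgebras, Lie superalgebras -/

section Super

variable {k : Type u} [Field k]

/-- The sign `(-1)^i` of a parity `i`. Thus `sgn k (i * j)` is `(-1)^{xy}` for homogeneous
elements `x`, `y` of parities `i`, `j`. -/
def sgn (k : Type u) [Field k] (i : ZMod 2) : k := if i = 0 then 1 else -1

variable {L : Type v} [AddCommGroup L] [Module k L]

/-- The projection of a superspace `L = L_0 ⊕ L_1` onto its homogeneous component of parity `i`. -/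
def parityProj {part : ZMod 2 → Submodule k L} (h : IsCompl (part 0) (part 1)) (i : ZMod 2) :
    L →ₗ[k] L :=
  if i = 0 then (part 0).projection (part 1) h else (part 1).projection (part 0) h.symm

lemma parityProj_of_mem {part : ZMod 2 → Submodule k L} (h : IsCompl (part 0) (part 1))
    {i j : ZMod 2} {x : L} (hx : x ∈ part j) :
    parityProj h i x = if i = j then x else 0 := by
  have hz : ∀ a : ZMod 2, a = 0 ∨ a = 1 := by decide
  rcases hz i with rfl | rfl <;> rcases hz j with rfl | rfl
  · simpa [parityProj] using Submodule.projection_apply_of_mem_left h hx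
  · simpa [parityProj] using hx
  · simpa [parityProj] using hx
  · simpa [parityProj] using Submodule.projection_apply_of_mem_left h.symm hx

lemma parityProj_mem {part : ZMod 2 → Submodule k L} (h : IsCompl (part 0) (part 1))
    (i : ZMod 2) (x : L) : parityProj h i x ∈ part i := by
  fin_cases i
  · exact Submodule.projection_apply_mem h x
  · exact Submodule.projection_apply_mem h.symm x

lemma parityProj_add {part : ZMod 2 → Submodule k L} (h : IsCompl (part 0) (part 1)) (x : L) :
    parityProj h 0 x + parityProj h 1 x = x := by
  simpa [parityProj] using Submodule.projection_add_projection_eq_self h x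

/-- The supercommutator `[x,y] = x y - (-1)^{xy} y x` of a product `mul`, extended bilinearly from
homogeneous elements; `p i` is the projection onto the homogeneous component of parity `i`. -/
def superCommutator (mul : L →ₗ[k] L →ₗ[k] L) (p : ZMod 2 → L →ₗ[k] L) : L →ₗ[k] L →ₗ[k] L :=
  ∑ i : ZMod 2, ∑ j : ZMod 2,
    (mul.compl₁₂ (p i) (p j) - sgn k (i * j) • mul.flip.compl₁₂ (p i) (p j))

lemma superCommutator_apply (mul : L →ₗ[k] L →ₗ[k] L) (p : ZMod 2 → L →ₗ[k] L) (x y : L) :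
    superCommutator mul p x y =
      ∑ i : ZMod 2, ∑ j : ZMod 2,
        (mul (p i x) (p j y) - sgn k (i * j) • mul (p j y) (p i x)) := by
  simp [superCommutator, LinearMap.sum_apply]

variable (k L) in
/-- The data of a superalgebra: the two homogeneous subspaces and a bilinear product. -/
structure SuperAlgebra where
  /-- the even part `part 0` and the odd part `part 1` -/
  part : ZMod 2 → Submodule k L
  /-- the product -/
  mul : L →ₗ[k] L →ₗ[k] L

/-- Lie superalgebras over a field of characteristic different from `2`. In characteristic `3` the
identity `cube` does not follow from the super Jacobi identity and is part of the definition. -/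
structure IsLieSuperalgebra (S : SuperAlgebra k L) : Prop where
  isCompl : IsCompl (S.part 0) (S.part 1)
  mul_mem : ∀ i j : ZMod 2, ∀ x ∈ S.part i, ∀ y ∈ S.part j, S.mul x y ∈ S.part (i + j)
  skew : ∀ i j : ZMod 2, ∀ x ∈ S.part i, ∀ y ∈ S.part j,
    S.mul x y + sgn k (i * j) • S.mul y x = 0
  jacobi : ∀ i j : ZMod 2, ∀ x ∈ S.part i, ∀ y ∈ S.part j, ∀ z : L,
    S.mul x (S.mul y z) = S.mul (S.mul x y) z + sgn k (i * j) • S.mul y (S.mul x z)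
  cube : ∀ x ∈ S.part 1, S.mul x (S.mul x x) = 0

/-- Isomorphism of superalgebras: an even linear bijection that is multiplicative. -/
def SuperAlgebra.IsIsomorphic (S : SuperAlgebra k L) {L' : Type w} [AddCommGroup L'] [Module k L']
    (S' : SuperAlgebra k L') : Prop :=
  ∃ e : L ≃ₗ[k] L', (∀ i, (S.part i).map (e : L →ₗ[k] L') = S'.part i) ∧
    ∀ x y, e (S.mul x y) = S'.mul (e x) (e y)

end Super

/-! ## Orthosymplectic triple systems -/

section OSTS

variable {k : Type u} [Field k] {T : Type v} [AddCommGroup T] [Module k T]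

variable (k T) in
/-- The data of a triple system with a bilinear form on a superspace `T = T_0 ⊕ T_1`:
`triple x y z` is `[xyz]` and `form x y` is `(x|y)`. -/
structure TripleSystem where
  /-- the even part `part 0` and the odd part `part 1` -/
  part : ZMod 2 → Submodule k T
  /-- the triple product -/
  triple : T →ₗ[k] T →ₗ[k] T →ₗ[k] T
  /-- the bilinear form -/
  form : LinearMap.BilinForm k T

/-- Orthosymplectic triple systems. -/
structure TripleSystem.IsOrthosymplectic (S : TripleSystem k T) : Prop where
  isCompl : IsCompl (S.part 0) (S.part 1)
  form_ne_zero : S.form ≠ 0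
  form_even_odd : ∀ x ∈ S.part 0, ∀ y ∈ S.part 1, S.form x y = 0
  form_odd_even : ∀ x ∈ S.part 1, ∀ y ∈ S.part 0, S.form x y = 0
  form_symm : ∀ x ∈ S.part 0, ∀ y ∈ S.part 0, S.form x y = S.form y x
  form_alt : ∀ x ∈ S.part 1, S.form x x = 0
  triple_mem : ∀ a b c : ZMod 2, ∀ x ∈ S.part a, ∀ y ∈ S.part b, ∀ z ∈ S.part c,
    S.triple x y z ∈ S.part (a + b + c)
  triple_skew : ∀ a b c : ZMod 2, ∀ x ∈ S.part a, ∀ y ∈ S.part b, ∀ z ∈ S.part c,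
    S.triple x y z + sgn k (a * b) • S.triple y x z = 0
  triple_form : ∀ a b c : ZMod 2, ∀ x ∈ S.part a, ∀ y ∈ S.part b, ∀ z ∈ S.part c,
    S.triple x y z + sgn k (b * c) • S.triple x z y =
      S.form x y • z + (sgn k (b * c) * S.form x z) • y - (2 * S.form y z) • x
  triple_deriv : ∀ a b c d e : ZMod 2, ∀ x ∈ S.part a, ∀ y ∈ S.part b, ∀ u ∈ S.part c,
    ∀ v ∈ S.part d, ∀ w ∈ S.part e,
    S.triple x y (S.triple u v w) =
      S.triple (S.triple x y u) v w + sgn k ((a + b) * c) • S.triple u (S.triple x y v) w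
        + sgn k ((a + b) * (c + d)) • S.triple u v (S.triple x y w)
  form_deriv : ∀ a b c d : ZMod 2, ∀ x ∈ S.part a, ∀ y ∈ S.part b, ∀ u ∈ S.part c,
    ∀ v ∈ S.part d,
    S.form (S.triple x y u) v + sgn k ((a + b) * c) * S.form u (S.triple x y v) = 0

/-- The endomorphisms of parity `i` of a superspace. -/
def endPart (part : ZMod 2 → Submodule k T) (i : ZMod 2) : Submodule k (Module.End k T) where
  carrier := {d | ∀ j, ∀ x ∈ part j, d x ∈ part (i + j)}
  add_mem' hd he j x hx := (part (i + j)).add_mem (hd j x hx) (he j x hx)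
  zero_mem' j _ _ := (part (i + j)).zero_mem
  smul_mem' _ _ hd j x hx := (part (i + j)).smul_mem _ (hd j x hx)

/-- The homogeneous component of parity `i` of an endomorphism of a superspace. -/
def endProj {part : ZMod 2 → Submodule k T} (h : IsCompl (part 0) (part 1)) (i : ZMod 2) :
    Module.End k T →ₗ[k] Module.End k T :=
  ∑ j : ZMod 2, (LinearMap.mulLeft k (parityProj h (i + j) : Module.End k T)) ∘ₗ
    (LinearMap.mulRight k (parityProj h j : Module.End k T))

lemma endProj_apply {part : ZMod 2 → Submodule k T} (h : IsCompl (part 0) (part 1)) (i : ZMod 2)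
    (d : Module.End k T) (x : T) :
    endProj h i d x = ∑ j : ZMod 2, parityProj h (i + j) (d (parityProj h j x)) := by
  simp [endProj, LinearMap.sum_apply]

lemma endProj_of_mem {part : ZMod 2 → Submodule k T} (h : IsCompl (part 0) (part 1))
    {i a : ZMod 2} {d : Module.End k T} (hd : d ∈ endPart part a) :
    endProj h i d = if i = a then d else 0 := by
  ext x
  rw [endProj_apply]
  have key : ∀ j, parityProj h (i + j) (d (parityProj h j x)) =
      if i = a then d (parityProj h j x) else 0 := by
    intro j
    rw [parityProj_of_mem h (hd j _ (parityProj_mem h j x))]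
    simp
  simp only [key]
  rw [show (Finset.univ : Finset (ZMod 2)) = {0, 1} from rfl, Finset.sum_pair (by decide)]
  split_ifs
  · rw [← map_add, parityProj_add]
  · simp

/-- The bracket `[d,e] = d e - (-1)^{de} e d` of the general linear Lie superalgebra `gl(T)`. -/
def glBracket {part : ZMod 2 → Submodule k T} (h : IsCompl (part 0) (part 1)) :
    Module.End k T →ₗ[k] Module.End k T →ₗ[k] Module.End k T :=
  superCommutator (LinearMap.mul k (Module.End k T)) (endProj h)

lemma glBracket_of_mem {part : ZMod 2 → Submodule k T} (h : IsCompl (part 0) (part 1))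
    {a b : ZMod 2} {d e : Module.End k T} (hd : d ∈ endPart part a) (he : e ∈ endPart part b) :
    glBracket h d e = d * e - sgn k (a * b) • (e * d) := by
  rw [glBracket, superCommutator_apply, Finset.sum_eq_single a, Finset.sum_eq_single b]
  · simp [endProj_of_mem h hd, endProj_of_mem h he]
  · intro j _ hj
    simp [endProj_of_mem h he, hj]
  · simp
  · intro i _ hi
    simp [endProj_of_mem h hd, hi]
  · simp

namespace TripleSystem

/-- The inner derivations `inder T`: the span of the maps `d_{x,y} = [xy.]`. -/
def inder (S : TripleSystem k T) : Submodule k (Module.End k T) :=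
  Submodule.span k {d | ∃ x y, d = S.triple x y}

instance (S : TripleSystem k T) : AddCommGroup S.inder := S.inder.addCommGroup

lemma triple_mem_inder (S : TripleSystem k T) (x y : T) : S.triple x y ∈ S.inder :=
  Submodule.subset_span ⟨x, y, rfl⟩

variable {S : TripleSystem k T}

lemma glBracket_triple_mem (h : S.IsOrthosymplectic) {a b c d : ZMod 2} {x y z t : T}
    (hx : x ∈ S.part a) (hy : y ∈ S.part b) (hz : z ∈ S.part c) (ht : t ∈ S.part d) :
    glBracket h.isCompl (S.triple x y) (S.triple z t) ∈ S.inder := by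
  have h1 : S.triple x y ∈ endPart S.part (a + b) := fun j w hw => h.triple_mem a b j x hx y hy w hw
  have h2 : S.triple z t ∈ endPart S.part (c + d) := fun j w hw => h.triple_mem c d j z hz t ht w hw
  rw [glBracket_of_mem h.isCompl h1 h2]
  have key : S.triple x y * S.triple z t - sgn k ((a + b) * (c + d)) • (S.triple z t * S.triple x y)
      = S.triple (S.triple x y z) t + sgn k ((a + b) * c) • S.triple z (S.triple x y t) := by
    ext w
    rw [← parityProj_add h.isCompl w]
    have aux : ∀ e, ∀ w' ∈ S.part e,
        (S.triple x y * S.triple z t -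
          sgn k ((a + b) * (c + d)) • (S.triple z t * S.triple x y)) w'
        = (S.triple (S.triple x y z) t + sgn k ((a + b) * c) • S.triple z (S.triple x y t)) w' := by
      intro e w' hw'
      have := h.triple_deriv a b c d e x hx y hy z hz t ht w' hw'
      simp only [LinearMap.sub_apply, LinearMap.smul_apply, Module.End.mul_apply,
        LinearMap.add_apply, this]
      abel
    rw [map_add, map_add, aux 0 _ (parityProj_mem h.isCompl 0 w),
      aux 1 _ (parityProj_mem h.isCompl 1 w)]
  rw [key]
  exact S.inder.add_mem (S.triple_mem_inder _ _)
    (S.inder.smul_mem _ (S.triple_mem_inder _ _))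

lemma glBracket_mem_inder (h : S.IsOrthosymplectic) {d e : Module.End k T}
    (hd : d ∈ S.inder) (he : e ∈ S.inder) : glBracket h.isCompl d e ∈ S.inder := by
  induction hd using Submodule.span_induction with
  | zero => simp
  | add d d' _ _ h1 h2 => simpa using S.inder.add_mem h1 h2
  | smul c d _ h1 => simpa using S.inder.smul_mem c h1
  | mem d hd =>
    obtain ⟨x, y, rfl⟩ := hd
    induction he using Submodule.span_induction with
    | zero => simp
    | add d d' _ _ h1 h2 => simpa using S.inder.add_mem h1 h2
    | smul c d _ h1 => simpa using S.inder.smul_mem c h1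
    | mem d hd =>
      obtain ⟨z, t, rfl⟩ := hd
      have m := fun (i : ZMod 2) (x : T) => parityProj_mem h.isCompl i x
      have g1 : ∀ i j l n, glBracket h.isCompl
          (S.triple (parityProj h.isCompl i x) (parityProj h.isCompl j y))
          (S.triple (parityProj h.isCompl l z) (parityProj h.isCompl n t)) ∈ S.inder :=
        fun i j l n => glBracket_triple_mem h (m i x) (m j y) (m l z) (m n t)
      have g2 : ∀ i j l, glBracket h.isCompl
          (S.triple (parityProj h.isCompl i x) (parityProj h.isCompl j y))
          (S.triple (parityProj h.isCompl l z) t) ∈ S.inder := fun i j l => by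
        rw [← parityProj_add h.isCompl t]
        simpa only [map_add] using S.inder.add_mem (g1 i j l 0) (g1 i j l 1)
      have g3 : ∀ i j, glBracket h.isCompl
          (S.triple (parityProj h.isCompl i x) (parityProj h.isCompl j y))
          (S.triple z t) ∈ S.inder := fun i j => by
        rw [← parityProj_add h.isCompl z]
        simpa only [map_add, LinearMap.add_apply] using S.inder.add_mem (g2 i j 0) (g2 i j 1)
      have g4 : ∀ i, glBracket h.isCompl
          (S.triple (parityProj h.isCompl i x) y) (S.triple z t) ∈ S.inder := fun i => by
        rw [← parityProj_add h.isCompl y]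
        simpa only [map_add, LinearMap.add_apply] using S.inder.add_mem (g3 i 0) (g3 i 1)
      rw [← parityProj_add h.isCompl x]
      simpa only [map_add, LinearMap.add_apply] using S.inder.add_mem (g4 0) (g4 1)

end TripleSystem

end OSTS

/-! ## The Lie superalgebra of an orthosymplectic triple system -/

section Construction

variable {k : Type u} [Field k]

variable (k) in
/-- A two-dimensional vector space with a nonzero alternating bilinear form `⟨.|.⟩`. -/
structure SymplecticPlane (V : Type v) [AddCommGroup V] [Module k V] where
  /-- the form -/
  form : LinearMap.BilinForm k V
  finrank_eq : Module.finrank k V = 2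
  alt : form.IsAlt
  ne_zero : form ≠ 0

variable {V : Type v} [AddCommGroup V] [Module k V]

/-- The symplectic Lie algebra `sp(V)`, as a space of endomorphisms. -/
def SymplecticPlane.sp (P : SymplecticPlane k V) : Submodule k (Module.End k V) where
  carrier := {s | ∀ a b, P.form (s a) b + P.form a (s b) = 0}
  add_mem' {s t} hs ht a b := by
    have h1 := hs a b
    have h2 := ht a b
    simp only [LinearMap.add_apply, map_add]
    linear_combination h1 + h2
  zero_mem' a b := by simp
  smul_mem' c s hs a b := by
    have h1 := hs a b
    simp only [LinearMap.smul_apply, map_smul, smul_eq_mul]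
    linear_combination c * h1

instance (P : SymplecticPlane k V) : AddCommGroup P.sp := P.sp.addCommGroup

/-- The Lie bracket `[s,t] = s t - t s` of `sp(V)`. -/
def SymplecticPlane.spBracket (P : SymplecticPlane k V) : P.sp →ₗ[k] P.sp →ₗ[k] P.sp :=
  LinearMap.mk₂ k
    (fun s t => ⟨(s : Module.End k V) * t - t * s, fun a b => by
      have h1 := s.2 (t.1 a) b
      have h2 := s.2 a (t.1 b)
      have h3 := t.2 (s.1 a) b
      have h4 := t.2 a (s.1 b)
      simp only [LinearMap.sub_apply, Module.End.mul_apply, map_sub]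
      linear_combination h1 + h2 - h3 - h4⟩)
    (fun s s' t => by ext : 1; simp [add_mul, mul_add]; abel)
    (fun c s t => by ext : 1; simp [smul_sub])
    (fun s t t' => by ext : 1; simp [add_mul, mul_add]; abel)
    (fun c s t => by ext : 1; simp [smul_sub])

/-- `γ_{u,v} = ⟨u|.⟩v + ⟨v|.⟩u`, an element of `sp(V)`. -/
def SymplecticPlane.gam (P : SymplecticPlane k V) : V →ₗ[k] V →ₗ[k] P.sp :=
  LinearMap.mk₂ k
    (fun u v => ⟨(P.form u).smulRight v + (P.form v).smulRight u, fun a b => by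
      have h1 := LinearMap.IsAlt.neg P.alt u a
      have h2 := LinearMap.IsAlt.neg P.alt v a
      simp only [LinearMap.add_apply, LinearMap.smulRight_apply, LinearMap.smul_apply, map_add,
        map_smul, smul_eq_mul]
      linear_combination -P.form v b * h1 - P.form u b * h2⟩)
    (fun u u' v => by ext : 2; simp [add_smul]; abel)
    (fun c u v => by ext : 2; simp [mul_smul, smul_comm c])
    (fun u v v' => by ext : 2; simp [add_smul]; abel)
    (fun c u v => by ext : 2; simp [mul_smul, smul_comm c])

variable {T : Type w} [AddCommGroup T] [Module k T]

namespace TripleSystem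

variable {S : TripleSystem k T}

/-- The map `x ↦ (-1)^x x` on a superspace. -/
def parityAut (h : S.IsOrthosymplectic) : T →ₗ[k] T :=
  ∑ i : ZMod 2, sgn k i • parityProj h.isCompl i

/-- The Lie superbracket of `inder T`. -/
def inderBracket (h : S.IsOrthosymplectic) : S.inder →ₗ[k] S.inder →ₗ[k] S.inder :=
  LinearMap.mk₂ k (fun d e => ⟨glBracket h.isCompl d e, glBracket_mem_inder h d.2 e.2⟩)
    (fun d d' e => by ext : 1; simp)
    (fun c d e => by ext : 1; simp)
    (fun d e e' => by ext : 1; simp)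
    (fun c d e => by ext : 1; simp)

/-- The bilinear map `(x, y) ↦ d_{x,y} = [xy.]` into `inder T`. -/
def innerDer (S : TripleSystem k T) : T →ₗ[k] T →ₗ[k] S.inder :=
  LinearMap.mk₂ k (fun x y => ⟨S.triple x y, S.triple_mem_inder x y⟩)
    (fun x x' y => by ext : 1; simp)
    (fun c x y => by ext : 1; simp)
    (fun x y y' => by ext : 1; simp)
    (fun c x y => by ext : 1; simp)

variable (V) in
/-- The action `[d, v ⊗ x] = (-1)^d v ⊗ d(x)` of `inder T` on `V ⊗ T`. -/
def inderAct (h : S.IsOrthosymplectic) : S.inder →ₗ[k] V ⊗[k] T →ₗ[k] V ⊗[k] T :=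
  ∑ i : ZMod 2, sgn k i • (LinearMap.lTensorHom V ∘ₗ endProj h.isCompl i ∘ₗ S.inder.subtype)

variable (V) in
/-- The opposite action `[v ⊗ x, d] = -(-1)^{d(x+1)} [d, v ⊗ x]`, forced by superanticommutativity
since the parity of `v ⊗ x` is the parity of `x` plus one (`V` is odd). -/
def inderActRight (h : S.IsOrthosymplectic) : V ⊗[k] T →ₗ[k] S.inder →ₗ[k] V ⊗[k] T :=
  -∑ i : ZMod 2, ∑ j : ZMod 2, (sgn k (i * (j + 1)) * sgn k i) •
    ((LinearMap.lTensorHom V ∘ₗ endProj h.isCompl i ∘ₗ S.inder.subtype).compl₁₂ LinearMap.id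
      ((parityProj h.isCompl j).lTensor V)).flip

/-- The action `[s, v ⊗ x] = s(v) ⊗ x` of `sp(V)` on `V ⊗ T`. -/
def spAct (P : SymplecticPlane k V) (T : Type w) [AddCommGroup T] [Module k T] :
    P.sp →ₗ[k] V ⊗[k] T →ₗ[k] V ⊗[k] T :=
  LinearMap.rTensorHom T ∘ₗ P.sp.subtype

/-- The component `V ⊗ T × V ⊗ T → sp(V)` of the bracket:
`(u ⊗ x, v ⊗ y) ↦ -(-1)^x (x|y) γ_{u,v}`. -/
def tensorToSp (h : S.IsOrthosymplectic) (P : SymplecticPlane k V) :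
    V ⊗[k] T →ₗ[k] V ⊗[k] T →ₗ[k] P.sp :=
  (TensorProduct.map₂ P.gam (-S.form ∘ₗ parityAut h)).compr₂
    (TensorProduct.rid k P.sp).toLinearMap

/-- The component `V ⊗ T × V ⊗ T → inder T` of the bracket:
`(u ⊗ x, v ⊗ y) ↦ (-1)^x ⟨u|v⟩ d_{x,y}`. -/
def tensorToInder (h : S.IsOrthosymplectic) (P : SymplecticPlane k V) :
    V ⊗[k] T →ₗ[k] V ⊗[k] T →ₗ[k] S.inder :=
  (TensorProduct.map₂ P.form (S.innerDer ∘ₗ parityAut h)).compr₂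
    (TensorProduct.lid k S.inder).toLinearMap

/-- The Lie superalgebra `g(T) = (sp(V) ⊕ inder T) ⊕ (V ⊗ T)` of an orthosymplectic triple system
`T`, where `V` is an odd two-dimensional space with a nonzero alternating form. -/
def lieSuperalgebra (h : S.IsOrthosymplectic) (P : SymplecticPlane k V) :
    SuperAlgebra k (P.sp × S.inder × (V ⊗[k] T)) where
  part i :=
    (if i = 0 then (⊤ : Submodule k P.sp) else ⊥).prod
      (((endPart S.part i).comap S.inder.subtype).prod
        (LinearMap.range ((S.part (i + 1)).subtype.lTensor V)))
  mul := LinearMap.mk₂ k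
    (fun X Y =>
      (P.spBracket X.1 Y.1 + tensorToSp h P X.2.2 Y.2.2,
        inderBracket h X.2.1 Y.2.1 + tensorToInder h P X.2.2 Y.2.2,
        spAct P T X.1 Y.2.2 - spAct P T Y.1 X.2.2
          + inderAct V h X.2.1 Y.2.2 + inderActRight V h X.2.2 Y.2.1))
    (fun X X' Y => by
      refine Prod.ext ?_ (Prod.ext ?_ ?_) <;>
        simp only [Prod.fst_add, Prod.snd_add, map_add, LinearMap.add_apply] <;> abel)
    (fun c X Y => by
      refine Prod.ext ?_ (Prod.ext ?_ ?_) <;>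
        simp only [Prod.smul_fst, Prod.smul_snd, map_smul, LinearMap.smul_apply, smul_add,
          smul_sub])
    (fun X Y Y' => by
      refine Prod.ext ?_ (Prod.ext ?_ ?_) <;>
        simp only [Prod.fst_add, Prod.snd_add, map_add, LinearMap.add_apply] <;> abel)
    (fun c X Y => by
      refine Prod.ext ?_ (Prod.ext ?_ ?_) <;>
        simp only [Prod.smul_fst, Prod.smul_snd, map_smul, LinearMap.smul_apply, smul_add,
          smul_sub])

end TripleSystem

/-- On decomposable homogeneous elements the bracket of `V ⊗ T` with itself is the expected one. -/
lemma lieSuperalgebra_mul_tmul {S : TripleSystem k T} (h : S.IsOrthosymplectic)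
    (P : SymplecticPlane k V) (u v : V) {a : ZMod 2} {x : T} (hx : x ∈ S.part a) (y : T) :
    (S.lieSuperalgebra h P).mul (0, 0, u ⊗ₜ x) (0, 0, v ⊗ₜ y) =
      (sgn k a • (-(S.form x y • P.gam u v)), sgn k a • (P.form u v • S.innerDer x y), 0) := by
  have hs : TripleSystem.parityAut h x = sgn k a • x := by
    simp [TripleSystem.parityAut, LinearMap.sum_apply, parityProj_of_mem h.isCompl hx]
  refine Prod.ext ?_ (Prod.ext ?_ ?_) <;>
    simp [TripleSystem.lieSuperalgebra, TripleSystem.tensorToSp, TripleSystem.tensorToInder, hs,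
      mul_smul]

/-- The brackets of `inder T` with `V ⊗ T`, on homogeneous elements. -/
lemma lieSuperalgebra_mul_der {S : TripleSystem k T} (h : S.IsOrthosymplectic)
    (P : SymplecticPlane k V) (v : V) {a b : ZMod 2} {x : T} (hx : x ∈ S.part a)
    (d : S.inder) (hd : (d : Module.End k T) ∈ endPart S.part b) :
    (S.lieSuperalgebra h P).mul (0, d, 0) (0, 0, v ⊗ₜ x) = (0, 0, sgn k b • v ⊗ₜ d.1 x) ∧
    (S.lieSuperalgebra h P).mul (0, 0, v ⊗ₜ x) (0, d, 0) =
      -(sgn k (b * (a + 1)) • ((0, 0, sgn k b • v ⊗ₜ d.1 x) : P.sp × S.inder × (V ⊗[k] T))) := by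
  have h1 : ∀ i, (endProj h.isCompl i d.1) = if i = b then d.1 else 0 :=
    fun i => endProj_of_mem h.isCompl hd
  have h2 : ∀ i, (parityProj h.isCompl i x) = if i = a then x else 0 :=
    fun i => parityProj_of_mem h.isCompl hx
  constructor <;> refine Prod.ext ?_ (Prod.ext ?_ ?_) <;>
    simp [TripleSystem.lieSuperalgebra, TripleSystem.inderAct, TripleSystem.inderActRight,
      LinearMap.sum_apply, h1, h2, mul_smul]
  · rw [Finset.sum_eq_single b (fun i _ hi => by simp [hi]) (by simp)]
    simp
  · rw [Finset.sum_eq_single b (fun i _ hi => by simp [hi]) (by simp),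
      Finset.sum_eq_single a (fun i _ hi => by simp [hi]) (by simp)]
    simp

end Construction

/-! ## The superalgebra `B(4,2)` and its trace zero part -/

namespace B42

variable {k : Type u} [Field k] {V : Type v} [AddCommGroup V] [Module k V]

variable (k V) in
/-- The involution `f ↦ tr(f) 1 - f` of `End(V)`; for a symplectic plane this is the symplectic
involution, see `form_bar`. -/
def bar : Module.End k V →ₗ[k] Module.End k V :=
  (LinearMap.trace k V).smulRight 1 - LinearMap.id

variable (k V) in
/-- `B(4,2)_0 = End(V)` and `B(4,2)_1 = V` inside `End(V) × V`. -/
def part (i : ZMod 2) : Submodule k (Module.End k V × V) :=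
  if i = 0 then LinearMap.range (LinearMap.inl k (Module.End k V) V)
  else LinearMap.range (LinearMap.inr k (Module.End k V) V)

lemma isCompl_part : IsCompl (part k V 0) (part k V 1) := by
  simpa [part] using LinearMap.isCompl_range_inl_inr (R := k) (M := Module.End k V) (M₂ := V)

/-- The superalgebra `B(4,2)`: composition on `End(V)`, `v · f = f(v)`, `f · v = \bar f(v)`, and
`u · v = ⟨.|u⟩ v`. -/
def algebra (P : SymplecticPlane k V) : SuperAlgebra k (Module.End k V × V) where
  part := part k V
  mul := LinearMap.mk₂ k
    (fun x y => (x.1 * y.1 + (P.form.flip x.2).smulRight y.2, bar k V x.1 y.2 + y.1 x.2))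
    (fun x x' y => by
      refine Prod.ext ?_ ?_
      · ext; simp [add_mul, add_smul]; abel
      · simp; abel)
    (fun c x y => by
      refine Prod.ext ?_ ?_
      · ext; simp [mul_smul]
      · simp)
    (fun x y y' => by
      refine Prod.ext ?_ ?_
      · ext; simp [mul_add]; abel
      · simp; abel)
    (fun c x y => by
      refine Prod.ext ?_ ?_
      · ext; simp [smul_comm c]
      · simp)

/-- The bilinear form `b` of the norm of `B(4,2)`: it is even, `b(u,v) = ⟨u|v⟩` on `V`, and on
`End(V)` it is the polar form `b(f,g) = det(f+g) - det f - det g = tr f tr g - tr(fg)` of the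
determinant, see `normForm_polar`. -/
def normForm (P : SymplecticPlane k V) : LinearMap.BilinForm k (Module.End k V × V) :=
  LinearMap.mk₂ k
    (fun x y => LinearMap.trace k V x.1 * LinearMap.trace k V y.1
      - LinearMap.trace k V (x.1 * y.1) + P.form x.2 y.2)
    (fun x x' y => by simp [add_mul]; ring)
    (fun c x y => by simp; ring)
    (fun x y y' => by simp [mul_add]; ring)
    (fun c x y => by simp; ring)

lemma form_bar (P : SymplecticPlane k V) (f : Module.End k V) (u v : V) :
    P.form (f u) v = P.form u (bar k V f v) := by
  have : Module.Finite k V := Module.finite_of_finrank_eq_succ P.finrank_eq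
  let b := Module.finBasisOfFinrankEq k V P.finrank_eq
  have h0 : ∀ x, P.form x x = 0 := P.alt
  have h10 : P.form (b 1) (b 0) = -P.form (b 0) (b 1) := by
    rw [LinearMap.IsAlt.neg P.alt]
  have e : ∀ i, f (b i) = LinearMap.toMatrix b b f 0 i • b 0 + LinearMap.toMatrix b b f 1 i • b 1 := by
    intro i
    conv_lhs => rw [← b.sum_repr (f (b i))]
    rw [Fin.sum_univ_two, LinearMap.toMatrix_apply, LinearMap.toMatrix_apply]
  have ht : LinearMap.trace k V f = LinearMap.toMatrix b b f 0 0 + LinearMap.toMatrix b b f 1 1 := by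
    rw [LinearMap.trace_eq_matrix_trace k b f, Matrix.trace_fin_two]
  rw [← b.sum_repr u, ← b.sum_repr v]
  simp only [Fin.sum_univ_two, bar, LinearMap.sub_apply, LinearMap.smulRight_apply, map_add,
    map_smul, e, ht, LinearMap.add_apply, LinearMap.smul_apply, Module.End.one_apply,
    LinearMap.id_apply, map_sub, smul_eq_mul, h0, h10]
  ring

lemma normForm_polar (P : SymplecticPlane k V) (f g : Module.End k V) :
    normForm P (f, 0) (g, 0) =
      LinearMap.det (f + g) - LinearMap.det f - LinearMap.det g := by
  have : Module.Finite k V := Module.finite_of_finrank_eq_succ P.finrank_eq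
  let b := Module.finBasisOfFinrankEq k V P.finrank_eq
  simp only [normForm, LinearMap.mk₂_apply, map_zero, add_zero]
  rw [← LinearMap.det_toMatrix b, ← LinearMap.det_toMatrix b f, ← LinearMap.det_toMatrix b g,
    LinearMap.trace_eq_matrix_trace k b f, LinearMap.trace_eq_matrix_trace k b g,
    LinearMap.trace_eq_matrix_trace k b (f * g), LinearMap.toMatrix_mul, map_add]
  simp only [Matrix.det_fin_two, Matrix.trace_fin_two, Matrix.mul_apply, Fin.sum_univ_two,
    Matrix.add_apply]
  ring

/-- The supercommutator `[x,y] = x y - (-1)^{xy} y x` of `B(4,2)`. -/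
def bracket (P : SymplecticPlane k V) :
    (Module.End k V × V) →ₗ[k] (Module.End k V × V) →ₗ[k] (Module.End k V × V) :=
  superCommutator (algebra P).mul (parityProj isCompl_part)

lemma parityProj_zero (x : Module.End k V × V) :
    parityProj (part := part k V) isCompl_part 0 x = (x.1, 0) := by
  have h1 : ((x.1, 0) : Module.End k V × V) ∈ part k V 0 := ⟨x.1, rfl⟩
  have h2 : ((0, x.2) : Module.End k V × V) ∈ part k V 1 := ⟨x.2, rfl⟩
  have hx : x = (x.1, 0) + (0, x.2) := by simp
  conv_lhs => rw [hx]
  rw [map_add, parityProj_of_mem _ h1, parityProj_of_mem _ h2]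
  simp

lemma parityProj_one (x : Module.End k V × V) :
    parityProj (part := part k V) isCompl_part 1 x = (0, x.2) := by
  have h := parityProj_add (part := part k V) isCompl_part x
  rw [parityProj_zero] at h
  rw [eq_sub_of_add_eq' h]
  ext <;> simp

/-- The trace zero elements `B(4,2)^0 = {x : b(1,x) = 0}`. -/
def traceZero (P : SymplecticPlane k V) : Submodule k (Module.End k V × V) :=
  LinearMap.ker (normForm P (1, 0))

instance (P : SymplecticPlane k V) : AddCommGroup (traceZero P) := (traceZero P).addCommGroup

lemma bracket_mem (P : SymplecticPlane k V) (x y : Module.End k V × V) :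
    bracket P x y ∈ traceZero P := by
  have : Module.Finite k V := Module.finite_of_finrank_eq_succ P.finrank_eq
  have h := LinearMap.IsAlt.neg P.alt x.2 y.2
  rw [traceZero, LinearMap.mem_ker, bracket, superCommutator_apply]
  simp only [show (Finset.univ : Finset (ZMod 2)) = {0, 1} from rfl,
    Finset.sum_pair (show (0 : ZMod 2) ≠ 1 by decide), parityProj_zero, parityProj_one]
  simp [algebra, normForm, sgn, LinearMap.trace_mul_comm k x.1 y.1, P.finrank_eq]
  linear_combination -h

/-- The Lie superbracket of the trace zero elements. -/
def zeroBracket (P : SymplecticPlane k V) :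
    traceZero P →ₗ[k] traceZero P →ₗ[k] traceZero P :=
  LinearMap.mk₂ k (fun x y => ⟨bracket P x y, bracket_mem P x y⟩)
    (fun x x' y => by ext : 1; simp)
    (fun c x y => by ext : 1; simp)
    (fun x y y' => by ext : 1; simp)
    (fun c x y => by ext : 1; simp)

/-- The superspace `B(4,2)^0` with the triple product `[xyz] = [[x,y],z]` and the bilinear form
`(x|y) = 2 b(x,y)`. -/
def tripleSystem (P : SymplecticPlane k V) : TripleSystem k (traceZero P) where
  part i := (part k V i).comap (traceZero P).subtype
  triple := (zeroBracket P).compr₂ (zeroBracket P)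
  form := (2 : k) • (normForm P).compl₁₂ (traceZero P).subtype (traceZero P).subtype

end B42

/-! ## Lie superalgebras with Cartan matrix -/

namespace Contragredient

variable {k : Type u} [Field k]

section Ideals

variable {L : Type v} [AddCommGroup L] [Module k L]

/-- Two-sided ideals of a nonassociative algebra. -/
def IsIdeal (mul : L →ₗ[k] L →ₗ[k] L) (J : Submodule k L) : Prop :=
  ∀ x, ∀ y ∈ J, mul x y ∈ J ∧ mul y x ∈ J

lemma isIdeal_sInf (mul : L →ₗ[k] L →ₗ[k] L) {s : Set (Submodule k L)}
    (h : ∀ J ∈ s, IsIdeal mul J) : IsIdeal mul (sInf s) := by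
  intro x y hy
  simp only [Submodule.mem_sInf] at hy ⊢
  exact ⟨fun J hJ => (h J hJ x y (hy J hJ)).1, fun J hJ => (h J hJ x y (hy J hJ)).2⟩

lemma isIdeal_sSup (mul : L →ₗ[k] L →ₗ[k] L) {s : Set (Submodule k L)}
    (h : ∀ J ∈ s, IsIdeal mul J) : IsIdeal mul (sSup s) := by
  intro x y hy
  rw [sSup_eq_iSup'] at hy ⊢
  induction hy using Submodule.iSup_induction' with
  | mem J y hy =>
    have := h J.1 J.2 x y hy
    exact ⟨Submodule.mem_iSup_of_mem J this.1, Submodule.mem_iSup_of_mem J this.2⟩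
  | zero => simp
  | add y z _ _ h1 h2 =>
    simpa using ⟨Submodule.add_mem _ h1.1 h2.1, Submodule.add_mem _ h1.2 h2.2⟩

/-- The product induced on the quotient by an ideal. -/
def quotMul (mul : L →ₗ[k] L →ₗ[k] L) (J : Submodule k L) (hJ : IsIdeal mul J) :
    (L ⧸ J) →ₗ[k] (L ⧸ J) →ₗ[k] (L ⧸ J) :=
  (mul.compr₂ J.mkQ).liftQ₂ J J
    (fun y hy => by
      rw [LinearMap.mem_ker]
      ext x
      simpa using (hJ x y hy).2)
    (fun y hy => by
      rw [LinearMap.mem_ker]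
      ext x
      simpa using (hJ x y hy).1)

lemma quotMul_mk (mul : L →ₗ[k] L →ₗ[k] L) (J : Submodule k L) (hJ : IsIdeal mul J) (x y : L) :
    quotMul mul J hJ (J.mkQ x) (J.mkQ y) = J.mkQ (mul x y) := rfl

end Ideals

/-- The generators `e_i`, `f_i`, `h_i`. -/
inductive Gen (n : ℕ) : Type
  | e (i : Fin n)
  | f (i : Fin n)
  | h (i : Fin n)

variable {n : ℕ}

/-- The `ℤ^n`-degree of a nonassociative word: `deg e_i = α_i`, `deg f_i = -α_i`, `deg h_i = 0`,
where `α_1, …, α_n` is the canonical basis of `ℤ^n`. -/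
def wordDegree : FreeMagma (Gen n) → (Fin n → ℤ)
  | .of (.e i) => Pi.single i 1
  | .of (.f i) => -Pi.single i 1
  | .of (.h _) => 0
  | .mul a b => wordDegree a + wordDegree b

/-- The parity of a nonassociative word: `e_i` and `f_i` have parity `τ i`, and `h_i` is even. -/
def wordParity (τ : Fin n → ZMod 2) : FreeMagma (Gen n) → ZMod 2
  | .of (.e i) => τ i
  | .of (.f i) => τ i
  | .of (.h _) => 0
  | .mul a b => wordParity τ a + wordParity τ b

variable (k n) in
/-- The free nonassociative algebra on the generators. -/
abbrev Free := FreeNonUnitalNonAssocAlgebra k (Gen n)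

variable (k n) in
/-- The product of the free nonassociative algebra. -/
def freeMul : Free k n →ₗ[k] Free k n →ₗ[k] Free k n := LinearMap.mul k (Free k n)

variable (k) in
/-- The homogeneous component of degree `d` of the free nonassociative algebra. -/
def freeDegreePart (d : Fin n → ℤ) : Submodule k (Free k n) :=
  Submodule.span k {x | ∃ m : FreeMagma (Gen n), wordDegree m = d ∧ x = MonoidAlgebra.ofMagma k _ m}

variable (k) in
/-- The homogeneous component of parity `i` of the free nonassociative algebra. -/
def freeParityPart (τ : Fin n → ZMod 2) (i : ZMod 2) : Submodule k (Free k n) :=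
  Submodule.span k
    {x | ∃ m : FreeMagma (Gen n), wordParity τ m = i ∧ x = MonoidAlgebra.ofMagma k _ m}

/-- A generator, as an element of the free nonassociative algebra. -/
def gen (g : Gen n) : Free k n := FreeNonUnitalNonAssocAlgebra.of k g

/-- The elements that vanish in the Lie superalgebra with generators `e_i`, `f_i`, `h_i` and
relations `[h_i,h_j] = 0`, `[h_i,e_j] = a_{ij} e_j`, `[h_i,f_j] = -a_{ij} f_j`,
`[e_i,f_j] = δ_{ij} h_i`: these relations and the defining identities of a Lie superalgebra. -/
inductive Relator (A : Matrix (Fin n) (Fin n) k) (τ : Fin n → ZMod 2) : Free k n → Prop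
  | hh (i j : Fin n) : Relator A τ (gen (.h i) * gen (.h j))
  | he (i j : Fin n) : Relator A τ (gen (.h i) * gen (.e j) - A i j • gen (.e j))
  | hf (i j : Fin n) : Relator A τ (gen (.h i) * gen (.f j) + A i j • gen (.f j))
  | ef (i j : Fin n) : Relator A τ (gen (.e i) * gen (.f j) - if i = j then gen (.h i) else 0)
  | skew (i j : ZMod 2) (x y : Free k n) (hx : x ∈ freeParityPart k τ i)
      (hy : y ∈ freeParityPart k τ j) : Relator A τ (x * y + sgn k (i * j) • (y * x))
  | jacobi (i j : ZMod 2) (x y z : Free k n) (hx : x ∈ freeParityPart k τ i)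
      (hy : y ∈ freeParityPart k τ j) :
      Relator A τ (x * (y * z) - (x * y) * z - sgn k (i * j) • (y * (x * z)))
  | cube (x : Free k n) (hx : x ∈ freeParityPart k τ 1) : Relator A τ (x * (x * x))

/-- The ideal of the free nonassociative algebra generated by the relators. -/
def relIdeal (A : Matrix (Fin n) (Fin n) k) (τ : Fin n → ZMod 2) : Submodule k (Free k n) :=
  sInf {J | IsIdeal (freeMul k n) J ∧ ∀ x, Relator A τ x → x ∈ J}

/-- The Lie superalgebra `\tilde g(A,τ)` with generators `e_i`, `f_i`, `h_i` and the relations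
above. -/
abbrev Tilde (A : Matrix (Fin n) (Fin n) k) (τ : Fin n → ZMod 2) := Free k n ⧸ relIdeal A τ

/-- The bracket of `\tilde g(A,τ)`. -/
def tildeMul (A : Matrix (Fin n) (Fin n) k) (τ : Fin n → ZMod 2) :
    Tilde A τ →ₗ[k] Tilde A τ →ₗ[k] Tilde A τ :=
  quotMul (freeMul k n) (relIdeal A τ) (isIdeal_sInf _ fun _ hJ => hJ.1)

/-- The homogeneous component of degree `d` of `\tilde g(A,τ)`. -/
def tildeDegreePart (A : Matrix (Fin n) (Fin n) k) (τ : Fin n → ZMod 2) (d : Fin n → ℤ) :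
    Submodule k (Tilde A τ) :=
  (freeDegreePart k d).map (relIdeal A τ).mkQ

/-- The subspace `h` of `\tilde g(A,τ)` spanned by the `h_i`. -/
def tildeCartan (A : Matrix (Fin n) (Fin n) k) (τ : Fin n → ZMod 2) : Submodule k (Tilde A τ) :=
  Submodule.span k (Set.range fun i => (relIdeal A τ).mkQ (gen (.h i)))

/-- The ideal `r`: the sum of all `ℤ^n`-homogeneous ideals of `\tilde g(A,τ)` that intersect `h`
trivially, i.e. the largest such ideal. -/
def maxIdeal (A : Matrix (Fin n) (Fin n) k) (τ : Fin n → ZMod 2) : Submodule k (Tilde A τ) :=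
  sSup {J | IsIdeal (tildeMul A τ) J ∧ J = ⨆ d, J ⊓ tildeDegreePart A τ d ∧
    J ⊓ tildeCartan A τ = ⊥}

/-- The underlying space of `g(A,τ) = \tilde g(A,τ) / r`. -/
abbrev Carrier (A : Matrix (Fin n) (Fin n) k) (τ : Fin n → ZMod 2) := Tilde A τ ⧸ maxIdeal A τ

/-- The Lie superalgebra `g(A,τ)` with Cartan matrix `A` and parities `τ`, for an invertible
matrix `A` (so that the minimal realization of `A` has the `h_i` as a basis of its Cartan
subalgebra). -/
def lieSuperalgebra (A : Matrix (Fin n) (Fin n) k) (τ : Fin n → ZMod 2) :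
    SuperAlgebra k (Carrier A τ) where
  part i := ((freeParityPart k τ i).map (relIdeal A τ).mkQ).map (maxIdeal A τ).mkQ
  mul := quotMul (tildeMul A τ) (maxIdeal A τ) (isIdeal_sSup _ fun _ hJ => hJ.1)

end Contragredient

/-- The Cartan matrix of `br(2;3)`. -/
def br23Matrix (k : Type u) [Field k] : Matrix (Fin 2) (Fin 2) k := !![0, -1; -2, 1]

/-- The Lie superalgebra `br(2;3)`, for a field of characteristic `3`: the Lie superalgebra with
Cartan matrix `(0 -1; -2 1)`, both simple roots being odd. -/
def br23 (k : Type u) [Field k] :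
    SuperAlgebra k (Contragredient.Carrier (br23Matrix k) fun _ => 1) :=
  Contragredient.lieSuperalgebra (br23Matrix k) fun _ => 1

end SuperTriple

end

/-! Since $\dim V=2$, one has $f+\bar f=\mathrm{tr}(f)1$, so the trace zero endomorphisms are
exactly $\mathfrak{sp}(V)$ and $T=\mathfrak{sp}(V)\oplus V$. The supercommutator on $T$ is
$[s,v]=-2s(v)$, $[u,v]=-\gamma_{u,v}$. As $-2=1$ in characteristic $3$, this is a Lie superalgebra,
a copy of $\mathfrak{osp}(1,2)$, with an invariant form. The triple product $[[x,y],z]$ inherits its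
derivation identities from the Jacobi identity and invariance; only the identity relating the triple
product to the form needs a separate check. Moreover $T$ is perfect with trivial centre, so
$\mathrm{inder}(T)=\mathrm{ad}\,T\cong T$, and $\mathfrak g(T)=\mathfrak{sp}(W)\oplus
T\oplus(W\otimes T)$ has dimension $3+5+10=18$.

Symplectic bases of $V$ and $W$ give bases of $T$ and $\mathfrak g(T)$ with integral structure
constants (`zeroTable`, `fullTable`). All identities are multilinear, except for $[x,[x,x]]=0$,
whose polarisation follows from the others; so they become finitely many congruences modulo $3$,
decided by computation (`IsLieTable.isLieSuperalgebra`). `TripleSystem.Coordinates` isolates what is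
needed of $T$ to pass to $\mathfrak g(T)$ (`mul_fullVec`).

The identification with $\mathfrak{br}(2;3)$ rests on a recognition principle valid for any Cartan
matrix (`IsGradedModel.isIsomorphic`). Let $G$ be a $\mathbb Z^n$-graded Lie superalgebra generated
by elements satisfying the relations of $\tilde{\mathfrak g}$, with independent $h_i$, such that a
nonzero element of degree $d\ne0$ is never annihilated by all of degree $-d$. Then $\tilde{\mathfrak
g}\to G$ has kernel $\mathfrak r$. The kernel is graded and misses the $h_i$, hence lies in
$\mathfrak r$. Conversely, the degree $0$ part of $\tilde{\mathfrak g}$ is spanned by the $h_i$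
(`tildeDegreePart_zero_le`), so a graded ideal missing them has no degree $0$ part, and
nondegeneracy forces its image in $G$ to vanish. For $\mathfrak g(T)$ the grading is by roots
$\pm(0,1),\pm(0,2),\pm(1,j),\pm(2,4)$ with $0\le j\le4$, all root spaces being lines
(`isGradedModel`). -/

noncomputable section

namespace SuperTriple

universe u v w

/-! ## Superalgebras given by a table of integral structure constants -/

section Table

variable {k : Type u} [Field k] {L : Type v} [AddCommGroup L] [Module k L]
variable {ι κ : Type*}

/-- The linear combination of the vectors `b i` encoded by a list of pairs (coefficient, index). -/
def evalList (k : Type u) [Field k] {L : Type v} [AddCommGroup L] [Module k L] (b : ι → L)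
    (l : List (ℤ × ι)) : L :=
  (l.map fun p => (p.1 : k) • b p.2).sum

@[simp] lemma evalList_nil (b : ι → L) : evalList k b [] = 0 := rfl

@[simp] lemma evalList_cons (b : ι → L) (p : ℤ × ι) (l : List (ℤ × ι)) :
    evalList k b (p :: l) = (p.1 : k) • b p.2 + evalList k b l := by simp [evalList]

@[simp] lemma evalList_append (b : ι → L) (l l' : List (ℤ × ι)) :
    evalList k b (l ++ l') = evalList k b l + evalList k b l' := by simp [evalList]

/-- Multiplication of an encoded linear combination by an integer. -/
def scaleList (c : ℤ) (l : List (ℤ × ι)) : List (ℤ × ι) := l.map fun p => (c * p.1, p.2)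

/-- Change of the indices of an encoded linear combination. -/
def reindexList (g : ι → κ) (l : List (ℤ × ι)) : List (ℤ × κ) := l.map fun p => (p.1, g p.2)

@[simp] lemma evalList_scaleList (b : ι → L) (c : ℤ) (l : List (ℤ × ι)) :
    evalList k b (scaleList c l) = (c : k) • evalList k b l := by
  induction l with
  | nil => simp [scaleList]
  | cons p l ih =>
    rw [scaleList, List.map_cons, ← scaleList, evalList_cons, evalList_cons, ih]
    simp [mul_smul]

/-- Removal of the vanishing terms of an encoded linear combination. -/
def dropZeros (l : List (ℤ × ι)) : List (ℤ × ι) := l.filter fun p => p.1 ≠ 0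

@[simp] lemma evalList_dropZeros (b : ι → L) (l : List (ℤ × ι)) :
    evalList k b (dropZeros l) = evalList k b l := by
  induction l with
  | nil => simp [dropZeros]
  | cons p l ih =>
    rw [dropZeros, List.filter_cons, ← dropZeros]
    split_ifs with h
    · simp [ih]
    · simp only [ne_eq, decide_not, Bool.not_eq_true', decide_eq_false_iff_not, not_not] at h
      simp [ih, h]

@[simp] lemma evalList_reindexList (b : κ → L) (g : ι → κ) (l : List (ℤ × ι)) :
    evalList k b (reindexList g l) = evalList k (fun i => b (g i)) l := by
  simp [evalList, reindexList, Function.comp_def]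

lemma map_evalList {M : Type w} [AddCommGroup M] [Module k M] (F : L →ₗ[k] M) (b : ι → L)
    (l : List (ℤ × ι)) : F (evalList k b l) = evalList k (fun i => F (b i)) l := by
  induction l with
  | nil => simp
  | cons p l ih => simp [ih]

/-- The product of encoded linear combinations, for the structure constants `c`. -/
def mulList (c : ι → ι → List (ℤ × ι)) (l l' : List (ℤ × ι)) : List (ℤ × ι) :=
  l.flatMap fun p => l'.flatMap fun q => scaleList (p.1 * q.1) (c p.2 q.2)

lemma mul_evalList {mul : L →ₗ[k] L →ₗ[k] L} {b : ι → L} {c : ι → ι → List (ℤ × ι)}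
    (h : ∀ i j, mul (b i) (b j) = evalList k b (c i j)) (l l' : List (ℤ × ι)) :
    mul (evalList k b l) (evalList k b l') = evalList k b (mulList c l l') := by
  induction l with
  | nil => simp [mulList]
  | cons p l ih =>
    rw [mulList, List.flatMap_cons, ← mulList, evalList_append, ← ih, evalList_cons, map_add,
      LinearMap.add_apply]
    congr 1
    clear ih
    induction l' with
    | nil => simp
    | cons q l' ih =>
      rw [List.flatMap_cons, evalList_append, ← ih, evalList_cons]
      simp [h, mul_smul]

/-- The coefficient of an index in an encoded linear combination. -/
def coeffList [DecidableEq ι] (l : List (ℤ × ι)) (i : ι) : ℤ :=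
  (l.map fun p => if p.2 = i then p.1 else 0).sum

/-- All coefficients of an encoded linear combination are divisible by `3`. -/
def VanishesMod3 [DecidableEq ι] (l : List (ℤ × ι)) : Prop :=
  ∀ p ∈ l, coeffList l p.2 % 3 = 0

instance [DecidableEq ι] (l : List (ℤ × ι)) : Decidable (VanishesMod3 l) :=
  inferInstanceAs (Decidable (∀ p ∈ l, coeffList l p.2 % 3 = 0))

/-- An index may be repeated in a list; collecting its coefficients is what makes the congruence
test meaningful. -/
lemma evalList_eq_sum [Fintype ι] [DecidableEq ι] (b : ι → L) (l : List (ℤ × ι)) :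
    evalList k b l = ∑ i, (coeffList l i : k) • b i := by
  induction l with
  | nil => simp [coeffList]
  | cons p l ih =>
    rw [evalList_cons, ih]
    simp [coeffList, add_smul, Finset.sum_add_distrib]

lemma intCast_eq_zero_of_emod [CharP k 3] {c : ℤ} (h : c % 3 = 0) : (c : k) = 0 :=
  (CharP.intCast_eq_zero_iff k 3 c).2 (by simpa using Int.dvd_of_emod_eq_zero h)

lemma evalList_eq_zero [Fintype ι] [DecidableEq ι] [CharP k 3] (b : ι → L) {l : List (ℤ × ι)}
    (h : VanishesMod3 l) : evalList k b l = 0 := by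
  rw [evalList_eq_sum]
  refine Finset.sum_eq_zero fun i _ => ?_
  rw [intCast_eq_zero_of_emod, zero_smul]
  -- `VanishesMod3` only inspects the indices occurring in the list; the others have coefficient
  -- $0$.
  by_cases hi : ∃ p ∈ l, p.2 = i
  · obtain ⟨p, hp, rfl⟩ := hi
    exact h p hp
  · push Not at hi
    rw [coeffList, List.map_congr_left (g := fun _ => (0 : ℤ)) fun p hp => if_neg (hi p hp)]
    simp

lemma evalList_mem {b : ι → L} {N : Submodule k L} {l : List (ℤ × ι)} (h : ∀ p ∈ l, b p.2 ∈ N) :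
    evalList k b l ∈ N := by
  induction l with
  | nil => simp
  | cons p l ih =>
    rw [evalList_cons]
    exact N.add_mem (N.smul_mem _ (h p (by simp))) (ih fun q hq => h q (by simp [hq]))

/-- Subspaces of the members of a decomposition that together span the whole space. -/
lemma eq_of_le_of_sup_eq_top {part sub : ZMod 2 → Submodule k L}
    (h : Disjoint (part 0) (part 1)) (hle : ∀ i, sub i ≤ part i) (hsup : sub 0 ⊔ sub 1 = ⊤)
    (i : ZMod 2) : sub i = part i := by
  refine le_antisymm (hle i) fun x hx => ?_
  obtain ⟨y, hy, z, hz, rfl⟩ := Submodule.mem_sup.1 (hsup ▸ Submodule.mem_top : x ∈ sub 0 ⊔ sub 1)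
  rw [Submodule.disjoint_def] at h
  have hi : ∀ i : ZMod 2, i = 0 ∨ i = 1 := by decide
  rcases hi i with rfl | rfl
  · have := h z (by simpa using sub_mem hx (hle 0 hy)) (hle 1 hz)
    simpa [this] using hy
  · have := h y (hle 0 hy) (by simpa using sub_mem hx (hle 1 hz))
    simpa [this] using hz

variable {part : ZMod 2 → Submodule k L} {p : ι → ZMod 2} {b : ι → L}

lemma sup_span_parity (hspan : ⊤ ≤ Submodule.span k (Set.range b)) :
    Submodule.span k (b '' {i | p i = 0}) ⊔ Submodule.span k (b '' {i | p i = 1}) = ⊤ := by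
  rw [← Submodule.span_union, ← Set.image_union, eq_top_iff]
  refine hspan.trans (Submodule.span_mono ?_)
  rintro _ ⟨i, rfl⟩
  refine ⟨i, ?_, rfl⟩
  have : ∀ q : ZMod 2, q = 0 ∨ q = 1 := by decide
  exact this (p i)

/-- A spanning family of homogeneous vectors spans the homogeneous components. -/
lemma span_parity_eq (hd : Disjoint (part 0) (part 1)) (hb : ∀ i, b i ∈ part (p i))
    (hspan : ⊤ ≤ Submodule.span k (Set.range b)) (i : ZMod 2) :
    Submodule.span k (b '' {j | p j = i}) = part i := by
  refine eq_of_le_of_sup_eq_top (sub := fun i => Submodule.span k (b '' {j | p j = i})) hd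
    (fun i => Submodule.span_le.2 ?_) (sup_span_parity hspan) i
  rintro _ ⟨j, rfl, rfl⟩
  exact hb j

/-- A homogeneous spanning family makes the sum of the two parts everything, so disjointness is all
that remains to be supplied. -/
lemma isCompl_of_span (hd : Disjoint (part 0) (part 1)) (hb : ∀ i, b i ∈ part (p i))
    (hspan : ⊤ ≤ Submodule.span k (Set.range b)) : IsCompl (part 0) (part 1) := by
  refine ⟨hd, codisjoint_iff.2 ?_⟩
  rw [← span_parity_eq hd hb hspan 0, ← span_parity_eq hd hb hspan 1, sup_span_parity hspan]

/-- The sign of a parity, as an integer. -/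
def intSgn (i : ZMod 2) : ℤ := if i = 0 then 1 else -1

@[simp] lemma intCast_intSgn (i : ZMod 2) : (intSgn i : k) = sgn k i := by
  unfold intSgn sgn; split_ifs <;> simp

/-- The identities of a Lie superalgebra modulo `3`, for integral structure constants. -/
structure IsLieTable [DecidableEq ι] (p : ι → ZMod 2) (c : ι → ι → List (ℤ × ι)) : Prop where
  parity : ∀ i j, ∀ q ∈ c i j, p q.2 = p i + p j
  skew : ∀ i j, VanishesMod3 (c i j ++ scaleList (intSgn (p i * p j)) (c j i))
  jacobi : ∀ i j l, VanishesMod3 (mulList c [(1, i)] (c j l) ++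
    scaleList (-1) (mulList c (c i j) [(1, l)] ++
      scaleList (intSgn (p i * p j)) (mulList c [(1, j)] (c i l))))
  cube : ∀ i, p i = 1 → VanishesMod3 (mulList c [(1, i)] (c i i))

/-- A superalgebra whose structure constants satisfy the identities is a Lie superalgebra. -/
theorem IsLieTable.isLieSuperalgebra [CharP k 3] [Fintype ι] [DecidableEq ι]
    {c : ι → ι → List (ℤ × ι)} (hc : IsLieTable p c) {S : SuperAlgebra k L}
    (hd : Disjoint (S.part 0) (S.part 1)) (hb : ∀ i, b i ∈ S.part (p i))
    (hspan : ⊤ ≤ Submodule.span k (Set.range b))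
    (hmul : ∀ i j, S.mul (b i) (b j) = evalList k b (c i j)) : IsLieSuperalgebra S := by
  have hpart := span_parity_eq hd hb hspan
  have hsingle : ∀ i, b i = evalList k b [(1, i)] := fun i => by simp
  have mul_mem : ∀ i j : ZMod 2, ∀ x ∈ S.part i, ∀ y ∈ S.part j, S.mul x y ∈ S.part (i + j) := by
    intro i j x hx y hy
    rw [← hpart] at hx hy
    induction hx using Submodule.span_induction with
    | zero => simp
    | add x x' _ _ h1 h2 => simpa using add_mem h1 h2
    | smul a x _ h1 => simpa using Submodule.smul_mem _ a h1
    | mem x hx =>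
      obtain ⟨i', rfl, rfl⟩ := hx
      induction hy using Submodule.span_induction with
      | zero => simp
      | add x x' _ _ h1 h2 => simpa using add_mem h1 h2
      | smul a x _ h1 => simpa using Submodule.smul_mem _ a h1
      | mem y hy =>
        obtain ⟨j', rfl, rfl⟩ := hy
        rw [hmul]
        exact evalList_mem fun q hq => hc.parity i' j' q hq ▸ hb q.2
  have skew : ∀ i j : ZMod 2, ∀ x ∈ S.part i, ∀ y ∈ S.part j,
      S.mul x y + sgn k (i * j) • S.mul y x = 0 := by
    intro i j x hx y hy
    rw [← hpart] at hx hy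
    induction hx using Submodule.span_induction with
    | zero => simp
    | add x x' _ _ h1 h2 =>
      simp only [map_add, LinearMap.add_apply, smul_add]
      linear_combination (norm := module) h1 + h2
    | smul a x _ h1 =>
      simp only [map_smul, LinearMap.smul_apply]
      linear_combination (norm := module) a • h1
    | mem x hx =>
      obtain ⟨i', rfl, rfl⟩ := hx
      induction hy using Submodule.span_induction with
      | zero => simp
      | add x x' _ _ h1 h2 =>
        simp only [map_add, LinearMap.add_apply, smul_add]
        linear_combination (norm := module) h1 + h2
      | smul a x _ h1 =>
        simp only [map_smul, LinearMap.smul_apply]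
        linear_combination (norm := module) a • h1
      | mem y hy =>
        obtain ⟨j', rfl, rfl⟩ := hy
        have := evalList_eq_zero (k := k) b (hc.skew i' j')
        simpa [hmul] using this
  have jacobi : ∀ i j : ZMod 2, ∀ x ∈ S.part i, ∀ y ∈ S.part j, ∀ z : L,
      S.mul x (S.mul y z) = S.mul (S.mul x y) z + sgn k (i * j) • S.mul y (S.mul x z) := by
    intro i j x hx y hy z
    have hz : z ∈ Submodule.span k (Set.range b) := hspan Submodule.mem_top
    rw [← hpart] at hx hy
    induction hx using Submodule.span_induction with
    | zero => simp
    | add x x' _ _ h1 h2 =>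
      simp only [map_add, LinearMap.add_apply, smul_add]
      linear_combination (norm := module) h1 + h2
    | smul a x _ h1 =>
      simp only [map_smul, LinearMap.smul_apply]
      linear_combination (norm := module) a • h1
    | mem x hx =>
      obtain ⟨i', rfl, rfl⟩ := hx
      induction hy using Submodule.span_induction with
      | zero => simp
      | add x x' _ _ h1 h2 =>
        simp only [map_add, LinearMap.add_apply, smul_add]
        linear_combination (norm := module) h1 + h2
      | smul a x _ h1 =>
        simp only [map_smul, LinearMap.smul_apply]
        linear_combination (norm := module) a • h1
      | mem y hy =>
        obtain ⟨j', rfl, rfl⟩ := hy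
        induction hz using Submodule.span_induction with
        | zero => simp
        | add x x' _ _ h1 h2 =>
          simp only [map_add, smul_add]
          linear_combination (norm := module) h1 + h2
        | smul a x _ h1 =>
          simp only [map_smul]
          linear_combination (norm := module) a • h1
        | mem z hz =>
          obtain ⟨l, rfl⟩ := hz
          have := evalList_eq_zero (k := k) b (hc.jacobi i' j' l)
          simp only [evalList_append, evalList_scaleList, ← mul_evalList hmul, ← hmul,
            ← hsingle, intCast_intSgn] at this
          rw [← sub_eq_zero]
          linear_combination (norm := (push_cast; module)) this
  refine ⟨isCompl_of_span hd hb hspan, mul_mem, skew, jacobi, ?_⟩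
  · intro x hx
    rw [← hpart] at hx
    induction hx using Submodule.span_induction with
    | zero => simp
    | add x y hx hy h1 h2 =>
      rw [hpart] at hx hy
      have s : ∀ x ∈ S.part 1, ∀ y ∈ S.part 1, S.mul x y = S.mul y x := fun x hx y hy => by
        have := skew 1 1 x hx y hy
        simpa [sgn, add_neg_eq_zero] using this
      -- The polarised cube identity follows from the Jacobi identity for $x,x,y$ and skew-symmetry.
      -- It makes the set of odd $x$ with $[x,[x,x]]=0$ closed under addition, so basis vectors
      -- suffice.
      have key : ∀ x ∈ S.part 1, ∀ y ∈ S.part 1,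
          S.mul x (S.mul x y) + S.mul x (S.mul x y) + S.mul y (S.mul x x) = 0 := by
        intro x hx y hy
        have h1 := jacobi 1 1 x hx x hx y
        have h2 := skew (1 + 1) 1 (S.mul x x) (mul_mem 1 1 x hx x hx) y hy
        simp only [sgn, mul_one, one_ne_zero, if_false, neg_smul, one_smul, CharTwo.add_self_eq_zero,
          if_true] at h1 h2
        linear_combination (norm := module) h1 + h2
      have e1 := key x hx y hy
      have e2 := key y hy x hx
      rw [s y hy x hx] at e2
      simp only [map_add, LinearMap.add_apply, s y hy x hx]
      linear_combination (norm := module) h1 + h2 + e1 + e2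
    | smul a x hx h1 =>
      rw [hpart] at hx
      simp [h1]
    | mem x hx =>
      obtain ⟨i, hi, rfl⟩ := hx
      have := evalList_eq_zero (k := k) b (hc.cube i hi)
      rwa [← mul_evalList hmul, ← hmul, ← hsingle] at this

end Table

/-! ## The structure constants -/

/-- The matrix of the form of a symplectic plane in a symplectic basis. -/
def planeForm : Fin 2 → Fin 2 → ℤ := ![![0, 1], ![-1, 0]]

/-- The position of `γ_{i,j}` in the basis `γ_{0,0}, γ_{0,1}, γ_{1,1}`. -/
def gamIndex : Fin 2 → Fin 2 → Fin 3 := ![![0, 1], ![1, 2]]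

/-- The action of the `γ_{i,j}` on a symplectic basis. -/
def spAction : Fin 3 → Fin 2 → List (ℤ × Fin 2) :=
  ![![[], [(2, 0)]], ![[(-1, 0)], [(1, 1)]], ![[(-2, 1)], []]]

/-- The brackets of the `γ_{i,j}`. -/
def spTable : Fin 3 → Fin 3 → List (ℤ × Fin 3) :=
  ![![[], [(2, 0)], [(4, 1)]], ![[(-2, 0)], [], [(2, 2)]], ![[(-4, 1)], [(-2, 2)], []]]

/-- The parities of the basis of the trace zero elements. -/
def zeroParity : Fin 3 ⊕ Fin 2 → ZMod 2 := Sum.elim (fun _ => 0) (fun _ => 1)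

/-- The supercommutators of the trace zero elements of `B(4,2)`. -/
def zeroTable : Fin 3 ⊕ Fin 2 → Fin 3 ⊕ Fin 2 → List (ℤ × (Fin 3 ⊕ Fin 2))
  | .inl i, .inl j => reindexList .inl (spTable i j)
  | .inl i, .inr j => reindexList .inr (scaleList (-2) (spAction i j))
  | .inr i, .inl j => reindexList .inr (scaleList 2 (spAction j i))
  | .inr i, .inr j => [(-1, .inl (gamIndex i j))]

/-- The form `(x|y) = 2 b(x,y)` on the trace zero elements of `B(4,2)`. -/
def zeroForm : Fin 3 ⊕ Fin 2 → Fin 3 ⊕ Fin 2 → ℤ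
  | .inl i, .inl j => (![![0, 0, 8], ![0, -4, 0], ![8, 0, 0]] : Fin 3 → Fin 3 → ℤ) i j
  | .inr i, .inr j => 2 * planeForm i j
  | _, _ => 0

/-- The parities of the basis of `g(T)` for the trace zero elements `T` of `B(4,2)`. -/
def fullParity : Fin 3 ⊕ (Fin 3 ⊕ Fin 2) ⊕ Fin 2 × (Fin 3 ⊕ Fin 2) → ZMod 2 :=
  Sum.elim (fun _ => 0) (Sum.elim zeroParity fun i => zeroParity i.2 + 1)

/-- The bracket of `g(T)` for the trace zero elements `T` of `B(4,2)`. -/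
def fullTable : Fin 3 ⊕ (Fin 3 ⊕ Fin 2) ⊕ Fin 2 × (Fin 3 ⊕ Fin 2) →
    Fin 3 ⊕ (Fin 3 ⊕ Fin 2) ⊕ Fin 2 × (Fin 3 ⊕ Fin 2) →
    List (ℤ × (Fin 3 ⊕ (Fin 3 ⊕ Fin 2) ⊕ Fin 2 × (Fin 3 ⊕ Fin 2)))
  | .inl i, .inl j => reindexList .inl (spTable i j)
  | .inl i, .inr (.inr (a, x)) => reindexList (fun b => .inr (.inr (b, x))) (spAction i a)
  | .inr (.inr (a, x)), .inl i =>
    reindexList (fun b => .inr (.inr (b, x))) (scaleList (-1) (spAction i a))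
  | .inr (.inl x), .inr (.inl y) => reindexList (fun z => .inr (.inl z)) (zeroTable x y)
  | .inr (.inl x), .inr (.inr (a, y)) =>
    reindexList (fun z => .inr (.inr (a, z))) (scaleList (intSgn (zeroParity x)) (zeroTable x y))
  | .inr (.inr (a, y)), .inr (.inl x) =>
    reindexList (fun z => .inr (.inr (a, z)))
      (scaleList (-(intSgn (zeroParity x * (zeroParity y + 1)) * intSgn (zeroParity x)))
        (zeroTable x y))
  | .inr (.inr (a, x)), .inr (.inr (b, y)) =>
    dropZeros ((-(intSgn (zeroParity x) * zeroForm x y), .inl (gamIndex a b)) ::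
      reindexList (fun z => .inr (.inl z))
        (scaleList (intSgn (zeroParity x) * planeForm a b) (zeroTable x y)))
  | _, _ => []

/-- Characteristic $3$ is essential: $s$ acts on $V$ by $-2s$, which respects commutators only if
$(-2)^2=-2$, that is, $6=0$. -/
lemma isLieTable_zeroTable : IsLieTable zeroParity zeroTable where
  parity := by decide +kernel
  skew := by decide +kernel
  jacobi := by decide +kernel
  cube := by decide +kernel

/-- The Lie superalgebra axioms of $\mathfrak g(T)$ are not deduced from those of an orthosymplectic
triple system; they are verified modulo $3$ on the 18 basis vectors. -/
lemma isLieTable_fullTable : IsLieTable fullParity fullTable where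
  parity := by decide +kernel
  skew := by decide +kernel
  jacobi := by decide +kernel
  cube := by decide +kernel

/-! ## Symplectic planes -/

namespace SymplecticPlane

variable {k : Type u} [Field k] {V : Type v} [AddCommGroup V] [Module k V]

lemma exists_symplecticBasis (P : SymplecticPlane k V) :
    ∃ b : Module.Basis (Fin 2) k V, ∀ i j, P.form (b i) (b j) = (planeForm i j : k) := by
  have : Module.Finite k V := Module.finite_of_finrank_eq_succ P.finrank_eq
  let b := Module.finBasisOfFinrankEq k V P.finrank_eq
  have h0 : ∀ x, P.form x x = 0 := P.alt
  have h10 : ∀ x y, P.form x y = -P.form y x := fun x y => by rw [LinearMap.IsAlt.neg P.alt]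
  -- In dimension two an alternating form is determined by this single value, and rescaling `b 0` by
  -- its inverse normalises the value to $1$.
  have hc : P.form (b 0) (b 1) ≠ 0 := by
    intro hc
    refine P.ne_zero (b.ext fun i => b.ext fun j => ?_)
    fin_cases i <;> fin_cases j <;> simp [h0, hc, h10 (b 1) (b 0)]
  refine ⟨b.unitsSMul ![Units.mk0 _ (inv_ne_zero hc), 1], fun i j => ?_⟩
  fin_cases i <;> fin_cases j <;>
    simp [Module.Basis.unitsSMul_apply, planeForm, h0, hc, h10 (b 1) (b 0), Units.smul_def]

variable (P : SymplecticPlane k V)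

lemma gam_apply (u v w : V) :
    (P.gam u v : Module.End k V) w = P.form u w • v + P.form v w • u := rfl

lemma gam_comm (u v : V) : P.gam u v = P.gam v u := by
  ext w
  rw [gam_apply, gam_apply, add_comm]

lemma coe_spBracket (s t : P.sp) :
    (P.spBracket s t : Module.End k V) = (s : Module.End k V) * t - t * s := rfl

/-- The elements `γ_{0,0}, γ_{0,1}, γ_{1,1}` of `sp(V)` for two vectors of `V`. -/
def gamVec (b : Fin 2 → V) : Fin 3 → P.sp :=
  ![P.gam (b 0) (b 0), P.gam (b 0) (b 1), P.gam (b 1) (b 1)]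

lemma gam_eq_gamVec (b : Fin 2 → V) (i j : Fin 2) :
    P.gam (b i) (b j) = P.gamVec b (gamIndex i j) := by
  fin_cases i <;> fin_cases j <;> simp [gamVec, gamIndex, P.gam_comm (b 1) (b 0)]

variable {P} {b : Module.Basis (Fin 2) k V}
  (hb : ∀ i j, P.form (b i) (b j) = (planeForm i j : k))

include hb

lemma gamVec_apply (i : Fin 3) (j : Fin 2) :
    (P.gamVec b i : Module.End k V) (b j) = evalList k b (spAction i j) := by
  fin_cases i <;> fin_cases j <;>
    simp [gamVec, gam_apply, hb, planeForm, spAction, two_smul, ← sub_eq_add_neg]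

lemma spBracket_gamVec (i j : Fin 3) :
    P.spBracket (P.gamVec b i) (P.gamVec b j) = evalList k (P.gamVec b) (spTable i j) := by
  ext1
  refine b.ext fun l => ?_
  rw [coe_spBracket, LinearMap.sub_apply, Module.End.mul_apply, Module.End.mul_apply,
    gamVec_apply hb, gamVec_apply hb, map_evalList, map_evalList]
  simp only [gamVec_apply hb]
  fin_cases i <;> fin_cases j <;> fin_cases l <;>
    simp [spAction, spTable, gamVec_apply hb] <;> module

lemma gamVec_span (h2 : (2 : k) ≠ 0) : ⊤ ≤ Submodule.span k (Set.range (P.gamVec b)) := by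
  intro s _
  have h0 : (s : Module.End k V) (b 0) = b.repr (s.1 (b 0)) 0 • b 0 + b.repr (s.1 (b 0)) 1 • b 1 := by
    conv_lhs => rw [← b.sum_repr (s.1 (b 0)), Fin.sum_univ_two]
  have h1 : (s : Module.End k V) (b 1) = b.repr (s.1 (b 1)) 0 • b 0 + b.repr (s.1 (b 1)) 1 • b 1 := by
    conv_lhs => rw [← b.sum_repr (s.1 (b 1)), Fin.sum_univ_two]
  -- Skewness of $s$ on this pair says that the trace of its matrix is zero.
  have hs := s.2 (b 0) (b 1)
  rw [h0, h1] at hs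
  simp [hb, planeForm] at hs
  -- In the basis $b$, $\gamma_{0,1}=\mathrm{diag}(-1,1)$, while $\gamma_{0,0}$ sends $b_1$ to
  -- $2b_0$ and $\gamma_{1,1}$ sends $b_0$ to $-2b_1$; the coefficients are read off from the matrix
  -- entries of $s$.
  have : s = (2⁻¹ * b.repr (s.1 (b 1)) 0) • P.gamVec b 0 + b.repr (s.1 (b 1)) 1 • P.gamVec b 1
      + (-2⁻¹ * b.repr (s.1 (b 0)) 1) • P.gamVec b 2 := by
    ext1
    refine b.ext fun l => ?_
    simp only [Submodule.coe_add, Submodule.coe_smul, LinearMap.add_apply, LinearMap.smul_apply,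
      gamVec_apply hb]
    fin_cases l
    · simp [spAction, smul_smul]
      refine h0.trans ?_
      rw [eq_neg_of_add_eq_zero_left hs, neg_smul]
      congr 2
      field_simp
    · simp [spAction, smul_smul]
      refine h1.trans ?_
      congr 2
      field_simp
  rw [this]
  refine add_mem (add_mem ?_ ?_) ?_ <;>
    exact Submodule.smul_mem _ _ (Submodule.subset_span ⟨_, rfl⟩)

lemma gamVec_linearIndependent (h2 : (2 : k) ≠ 0) : LinearIndependent k (P.gamVec b) := by
  rw [Fintype.linearIndependent_iff]
  intro g hg
  have e : ∀ j, g 0 • evalList k b (spAction 0 j) + g 1 • evalList k b (spAction 1 j)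
      + g 2 • evalList k b (spAction 2 j) = 0 := by
    intro j
    have := congrArg (fun s : P.sp => (s : Module.End k V) (b j)) hg
    simpa [Fin.sum_univ_three, gamVec_apply hb] using this
  have hl := Fintype.linearIndependent_iff.1 b.linearIndependent
  have e0 := hl ![-g 1, -2 * g 2] (by
    have := e 0
    simp [spAction] at this
    simp [Fin.sum_univ_two]
    linear_combination (norm := module) this)
  have e1 := hl ![2 * g 0, g 1] (by
    have := e 1
    simp [spAction] at this
    simp [Fin.sum_univ_two]
    linear_combination (norm := module) this)
  intro i
  fin_cases i
  · simpa [h2] using e1 0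
  · simpa using e1 1
  · simpa [h2] using e0 1

/-- On trace zero maps the polar form of the determinant is $-\mathrm{tr}(fg)$, so these traces give
the form on the even part of $T$. -/
lemma trace_gamVec_mul (i j : Fin 3) :
    LinearMap.trace k V (P.gamVec b i * P.gamVec b j : Module.End k V) =
      (((![![0, 0, -4], ![0, 2, 0], ![-4, 0, 0]] : Fin 3 → Fin 3 → ℤ) i j : ℤ) : k) := by
  rw [LinearMap.trace_eq_matrix_trace k b, Matrix.trace_fin_two]
  simp only [LinearMap.toMatrix_apply, Module.End.mul_apply, gamVec_apply hb, map_evalList]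
  fin_cases i <;> fin_cases j <;> simp [spAction] <;> norm_num

-- By `form_bar`, $\langle f(u)|v\rangle+\langle u|f(v)\rangle=\langle u|(\bar f+f)(v)\rangle$, and
-- $\bar f+f=\mathrm{tr}(f)1$; the form is nonzero.
omit hb in
variable (P) in
lemma mem_sp_iff (f : Module.End k V) : f ∈ P.sp ↔ LinearMap.trace k V f = 0 := by
  have h : ∀ u v, P.form (f u) v + P.form u (f v) = LinearMap.trace k V f * P.form u v := by
    intro u v
    simp [B42.form_bar, B42.bar]
  change (∀ u v, P.form (f u) v + P.form u (f v) = 0) ↔ _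
  simp only [h, mul_eq_zero]
  refine ⟨fun H => ?_, fun H _ _ => Or.inl H⟩
  by_contra h0
  exact P.ne_zero (LinearMap.ext₂ fun u v => (H u v).resolve_left h0)

end SymplecticPlane

/-! ## The trace zero elements of `B(4,2)` -/

namespace B42

variable {k : Type u} [Field k] {V : Type v} [AddCommGroup V] [Module k V]
variable (P : SymplecticPlane k V)

lemma bracket_apply (x y : Module.End k V × V) : bracket P x y =
    (x.1 * y.1 - y.1 * x.1 + ((P.form.flip x.2).smulRight y.2 + (P.form.flip y.2).smulRight x.2),
      bar k V x.1 y.2 + y.1 x.2 - (x.1 y.2 + bar k V y.1 x.2)) := by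
  rw [bracket, superCommutator_apply]
  simp only [show (Finset.univ : Finset (ZMod 2)) = {0, 1} from rfl,
    Finset.sum_pair (show (0 : ZMod 2) ≠ 1 by decide), parityProj_zero, parityProj_one]
  refine Prod.ext ?_ ?_
  · simp [algebra, sgn]
  · simp [algebra, sgn]
    abel

/-- Because $\mathrm{tr}(1)=2$, one gets $\mathrm b(1,f)=2\,\mathrm{tr} f-\mathrm{tr} f=\mathrm{tr}
f$. -/
lemma mem_traceZero (x : Module.End k V × V) : x ∈ traceZero P ↔ LinearMap.trace k V x.1 = 0 := by
  have : Module.Finite k V := Module.finite_of_finrank_eq_succ P.finrank_eq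
  rw [traceZero, LinearMap.mem_ker]
  simp only [normForm, LinearMap.mk₂_apply, LinearMap.trace_one, P.finrank_eq, one_mul, map_zero,
    LinearMap.zero_apply, add_zero]
  rw [show ((2 : ℕ) : k) * LinearMap.trace k V x.1 - LinearMap.trace k V x.1 =
    LinearMap.trace k V x.1 by push_cast; ring]

/-- The identification of `B(4,2)^0` with `sp(V) ⊕ V`. -/
def zeroEquiv : (P.sp × V) ≃ₗ[k] traceZero P where
  toFun x := ⟨(x.1, x.2), (mem_traceZero P _).2 ((P.mem_sp_iff _).1 x.1.2)⟩
  invFun x := (⟨x.1.1, (P.mem_sp_iff _).2 ((mem_traceZero P _).1 x.2)⟩, x.1.2)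
  map_add' _ _ := rfl
  map_smul' _ _ := rfl
  left_inv _ := rfl
  right_inv _ := rfl

lemma coe_zeroEquiv (x : P.sp × V) :
    ((zeroEquiv P x : traceZero P) : Module.End k V × V) = ((x.1 : Module.End k V), x.2) := rfl

lemma bar_coe_sp (s : P.sp) : bar k V s = -s := by
  simp [bar, (P.mem_sp_iff _).1 s.2]

/-- For $s\in\mathfrak{sp}(V)$, $\bar s=-s$ gives $s\cdot v=-s(v)$ and $v\cdot s=s(v)$, whence the
factors $\mp2$. For odd $u,v$ the sign of the supercommutator symmetrises $\langle\cdot|u\rangle v$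
into $-\gamma_{u,v}$. -/
lemma zeroBracket_zeroEquiv (x y : P.sp × V) :
    zeroBracket P (zeroEquiv P x) (zeroEquiv P y) =
      zeroEquiv P (P.spBracket x.1 y.1 - P.gam x.2 y.2,
        (-2 : k) • x.1.1 y.2 + (2 : k) • y.1.1 x.2) := by
  ext1
  change bracket P _ _ = _
  have h : ∀ u, P.form.flip u = -P.form u := fun u => by
    ext w
    simp [← LinearMap.IsAlt.neg P.alt u w]
  rw [bracket_apply, coe_zeroEquiv, coe_zeroEquiv, coe_zeroEquiv]
  refine Prod.ext ?_ ?_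
  · ext w
    simp [SymplecticPlane.coe_spBracket, SymplecticPlane.gam_apply, h]
    abel
  · simp [bar_coe_sp]
    module

lemma tripleSystem_form (x y : traceZero P) : (tripleSystem P).form x y =
    2 * (P.form x.1.2 y.1.2 - LinearMap.trace k V (x.1.1 * y.1.1)) := by
  simp only [tripleSystem, LinearMap.smul_apply, LinearMap.compl₁₂_apply, Submodule.subtype_apply,
    normForm, LinearMap.mk₂_apply, (mem_traceZero P x.1).1 x.2, smul_eq_mul]
  ring

lemma tripleSystem_triple (x y : traceZero P) :
    (tripleSystem P).triple x y = zeroBracket P (zeroBracket P x y) := rfl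

lemma mem_part_zero (x : traceZero P) : x ∈ (tripleSystem P).part 0 ↔ x.1.2 = 0 := by
  change x.1 ∈ part k V 0 ↔ _
  refine ⟨?_, fun h => ⟨x.1.1, Prod.ext rfl h.symm⟩⟩
  rintro ⟨f, hf⟩
  rw [← hf]
  rfl

lemma mem_part_one (x : traceZero P) : x ∈ (tripleSystem P).part 1 ↔ x.1.1 = 0 := by
  change x.1 ∈ part k V 1 ↔ _
  refine ⟨?_, fun h => ⟨x.1.2, Prod.ext h.symm rfl⟩⟩
  rintro ⟨f, hf⟩
  rw [← hf]
  rfl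

lemma disjoint_part : Disjoint ((tripleSystem P).part 0) ((tripleSystem P).part 1) := by
  rw [Submodule.disjoint_def]
  intro x h0 h1
  ext1
  exact Prod.ext ((mem_part_one P x).1 h1) ((mem_part_zero P x).1 h0)

/-- The vectors of `B(4,2)^0` given by two vectors of `V`. -/
def zeroVec (b : Fin 2 → V) : Fin 3 ⊕ Fin 2 → traceZero P :=
  Sum.elim (fun i => zeroEquiv P (P.gamVec b i, 0)) (fun j => zeroEquiv P (0, b j))

lemma zeroVec_mem (b : Fin 2 → V) (i : Fin 3 ⊕ Fin 2) :
    zeroVec P b i ∈ (tripleSystem P).part (zeroParity i) := by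
  rcases i with i | i
  · exact (mem_part_zero P _).2 rfl
  · exact (mem_part_one P _).2 rfl

variable {P} {b : Module.Basis (Fin 2) k V}
  (hb : ∀ i j, P.form (b i) (b j) = (planeForm i j : k))

/-- The basis of `B(4,2)^0` given by a symplectic basis of `V`. -/
def zeroBasis (h2 : (2 : k) ≠ 0) : Module.Basis (Fin 3 ⊕ Fin 2) k (traceZero P) :=
  (((Module.Basis.mk (SymplecticPlane.gamVec_linearIndependent hb h2)
    (SymplecticPlane.gamVec_span hb h2)).prod b).map (zeroEquiv P))

lemma coe_zeroBasis (h2 : (2 : k) ≠ 0) : ⇑(zeroBasis hb h2) = zeroVec P b := by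
  funext i
  rcases i with i | i <;> simp [zeroBasis, zeroVec]

include hb

lemma zeroBracket_zeroVec (i j : Fin 3 ⊕ Fin 2) :
    zeroBracket P (zeroVec P b i) (zeroVec P b j) = evalList k (zeroVec P b) (zeroTable i j) := by
  have hl : ∀ l, evalList k (fun i => zeroEquiv P (P.gamVec b i, 0)) l =
      zeroEquiv P (evalList k (P.gamVec b) l, 0) := fun l =>
    (map_evalList ((zeroEquiv P).toLinearMap ∘ₗ LinearMap.inl k P.sp V) _ l).symm
  have hr : ∀ l, evalList k (fun i => zeroEquiv P (0, b i)) l =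
      zeroEquiv P (0, evalList k b l) := fun l =>
    (map_evalList ((zeroEquiv P).toLinearMap ∘ₗ LinearMap.inr k P.sp V) _ l).symm
  rcases i with i | i <;> rcases j with j | j
  · simp [zeroVec, zeroBracket_zeroEquiv, zeroTable, hl, SymplecticPlane.spBracket_gamVec hb]
  · simp [zeroVec, zeroBracket_zeroEquiv, zeroTable, hr, SymplecticPlane.gamVec_apply hb]
  · simp [zeroVec, zeroBracket_zeroEquiv, zeroTable, hr, SymplecticPlane.gamVec_apply hb]
  · simp [zeroVec, zeroBracket_zeroEquiv, zeroTable, SymplecticPlane.gam_eq_gamVec, ← map_neg]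

lemma form_zeroVec (i j : Fin 3 ⊕ Fin 2) :
    (tripleSystem P).form (zeroVec P b i) (zeroVec P b j) = (zeroForm i j : k) := by
  rw [tripleSystem_form]
  rcases i with i | i <;> rcases j with j | j
  · simp only [zeroVec, Sum.elim_inl, coe_zeroEquiv, SymplecticPlane.trace_gamVec_mul hb,
      zeroForm]
    fin_cases i <;> fin_cases j <;> simp <;> norm_num
  · simp [zeroVec, coe_zeroEquiv, zeroForm]
  · simp [zeroVec, coe_zeroEquiv, zeroForm]
  · simp [zeroVec, coe_zeroEquiv, zeroForm, hb]

end B42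

/-- The identities relating the triple product and the form of the trace zero elements. -/
lemma zeroTable_form (i j l : Fin 3 ⊕ Fin 2) :
    VanishesMod3 (mulList zeroTable (zeroTable i j) [(1, l)] ++
      (scaleList (intSgn (zeroParity j * zeroParity l))
        (mulList zeroTable (zeroTable i l) [(1, j)]) ++
      scaleList (-1) [(zeroForm i j, l),
        (intSgn (zeroParity j * zeroParity l) * zeroForm i l, j), (-2 * zeroForm j l, i)])) := by
  revert i j l
  decide +kernel

/-- The congruence behind $([x,y]|z)=(x|[y,z])$ on basis vectors. -/
lemma zeroTable_invariant (i j l : Fin 3 ⊕ Fin 2) :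
    (((zeroTable i j).map fun q => q.1 * zeroForm q.2 l).sum -
      ((zeroTable j l).map fun q => q.1 * zeroForm i q.2).sum) % 3 = 0 := by
  revert i j l
  decide +kernel

lemma two_ne_zero_of_charP_three (k : Type u) [Field k] [CharP k 3] : (2 : k) ≠ 0 := by
  intro h
  have := (CharP.cast_eq_zero_iff k 3 2).1 (by exact_mod_cast h)
  omega

/-! ### The orthosymplectic axioms for the trace zero elements. -/

namespace B42

variable {k : Type u} [Field k] {V : Type v} [AddCommGroup V] [Module k V]
variable (P : SymplecticPlane k V)

/-- The superalgebra `B(4,2)^0` with the supercommutator as product. -/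
def zeroAlgebra : SuperAlgebra k (traceZero P) where
  part := (tripleSystem P).part
  mul := zeroBracket P

lemma zeroVec_span [CharP k 3] {b : Module.Basis (Fin 2) k V}
    (hb : ∀ i j, P.form (b i) (b j) = (planeForm i j : k)) :
    ⊤ ≤ Submodule.span k (Set.range (zeroVec P b)) := by
  rw [← coe_zeroBasis hb (two_ne_zero_of_charP_three k), Module.Basis.span_eq]

lemma isLieSuperalgebra_zeroAlgebra [CharP k 3] : IsLieSuperalgebra (zeroAlgebra P) := by
  obtain ⟨b, hb⟩ := P.exists_symplecticBasis
  exact isLieTable_zeroTable.isLieSuperalgebra (disjoint_part P) (zeroVec_mem P b)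
    (zeroVec_span P hb) (zeroBracket_zeroVec hb)

/-- Both sides are trilinear and no sign occurs, so basis vectors suffice. Invariance is the source
of the axiom `form_deriv`. -/
lemma form_zeroBracket [CharP k 3] (x y z : traceZero P) :
    (tripleSystem P).form (zeroBracket P x y) z = (tripleSystem P).form x (zeroBracket P y z) := by
  obtain ⟨b, hb⟩ := P.exists_symplecticBasis
  have hx := zeroVec_span P hb (Submodule.mem_top (x := x))
  have hy := zeroVec_span P hb (Submodule.mem_top (x := y))
  have hz := zeroVec_span P hb (Submodule.mem_top (x := z))
  induction hx using Submodule.span_induction with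
  | zero => simp
  | add x x' _ _ h1 h2 => simp only [map_add, LinearMap.add_apply, h1, h2]
  | smul a x _ h1 => simp only [map_smul, LinearMap.smul_apply, h1]
  | mem x hx =>
    obtain ⟨i, rfl⟩ := hx
    induction hy using Submodule.span_induction with
    | zero => simp
    | add x x' _ _ h1 h2 => simp only [map_add, LinearMap.add_apply, h1, h2]
    | smul a x _ h1 => simp only [map_smul, LinearMap.smul_apply, h1]
    | mem y hy =>
      obtain ⟨j, rfl⟩ := hy
      induction hz using Submodule.span_induction with
      | zero => simp
      | add x x' _ _ h1 h2 => simp only [map_add, h1, h2]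
      | smul a x _ h1 => simp only [map_smul, h1]
      | mem z hz =>
        obtain ⟨l, rfl⟩ := hz
        have h := intCast_eq_zero_of_emod (k := k) (zeroTable_invariant i j l)
        have e1 := map_evalList (LinearMap.flip (tripleSystem P).form (zeroVec P b l))
          (zeroVec P b) (zeroTable i j)
        have e2 := map_evalList ((tripleSystem P).form (zeroVec P b i))
          (zeroVec P b) (zeroTable j l)
        simp only [LinearMap.flip_apply, form_zeroVec hb] at e1 e2
        rw [zeroBracket_zeroVec hb, zeroBracket_zeroVec hb, e1, e2, ← sub_eq_zero, ← h]
        simp [evalList, Function.comp_def]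

/-- This axiom is not formal for an iterated Lie superbracket with an invariant form. The sign
depends only on the parities, so trilinearity reduces it to `zeroTable_form`. -/
lemma tripleSystem_triple_form [CharP k 3] {a b c : ZMod 2} {x y z : traceZero P}
    (hx : x ∈ (tripleSystem P).part a) (hy : y ∈ (tripleSystem P).part b)
    (hz : z ∈ (tripleSystem P).part c) :
    zeroBracket P (zeroBracket P x y) z + sgn k (b * c) • zeroBracket P (zeroBracket P x z) y =
      (tripleSystem P).form x y • z + (sgn k (b * c) * (tripleSystem P).form x z) • y
        - (2 * (tripleSystem P).form y z) • x := by
  obtain ⟨v, hv⟩ := P.exists_symplecticBasis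
  have hpart := span_parity_eq (disjoint_part P) (zeroVec_mem P v) (zeroVec_span P hv)
  rw [← hpart] at hx hy hz
  induction hx using Submodule.span_induction with
  | zero => simp
  | add x x' _ _ h1 h2 =>
    simp only [map_add, LinearMap.add_apply]
    linear_combination (norm := module) h1 + h2
  | smul a x _ h1 =>
    simp only [map_smul, LinearMap.smul_apply, smul_eq_mul]
    linear_combination (norm := module) a • h1
  | mem x hx =>
    obtain ⟨i, rfl, rfl⟩ := hx
    induction hy using Submodule.span_induction with
    | zero => simp
    | add x x' _ _ h1 h2 =>
      simp only [map_add, LinearMap.add_apply]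
      linear_combination (norm := module) h1 + h2
    | smul a x _ h1 =>
      simp only [map_smul, LinearMap.smul_apply, smul_eq_mul]
      linear_combination (norm := module) a • h1
    | mem y hy =>
      obtain ⟨j, rfl, rfl⟩ := hy
      induction hz using Submodule.span_induction with
      | zero => simp
      | add x x' _ _ h1 h2 =>
        simp only [map_add, LinearMap.add_apply]
        linear_combination (norm := module) h1 + h2
      | smul a x _ h1 =>
        simp only [map_smul, LinearMap.smul_apply, smul_eq_mul]
        linear_combination (norm := module) a • h1
      | mem z hz =>
        obtain ⟨l, rfl, rfl⟩ := hz
        have hsingle : ∀ i, zeroVec P v i = evalList k (zeroVec P v) [(1, i)] := fun i => by simp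
        have h := evalList_eq_zero (k := k) (zeroVec P v) (zeroTable_form i j l)
        simp only [evalList_append, evalList_scaleList, ← mul_evalList (zeroBracket_zeroVec hv),
          ← zeroBracket_zeroVec hv, ← hsingle, intCast_intSgn, evalList_cons, evalList_nil] at h
        simp only [form_zeroVec hv]
        push_cast [intCast_intSgn] at h
        linear_combination (norm := module) h

theorem isOrthosymplectic_tripleSystem [CharP k 3] : (tripleSystem P).IsOrthosymplectic := by
  have hL := isLieSuperalgebra_zeroAlgebra P
  have hmem : ∀ a b, ∀ x ∈ (tripleSystem P).part a, ∀ y ∈ (tripleSystem P).part b,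
    zeroBracket P x y ∈ (tripleSystem P).part (a + b) := hL.mul_mem
  have hskew : ∀ i j : ZMod 2, ∀ x ∈ (tripleSystem P).part i, ∀ y ∈ (tripleSystem P).part j,
    zeroBracket P x y + sgn k (i * j) • zeroBracket P y x = 0 := hL.skew
  have hjac : ∀ i j : ZMod 2, ∀ x ∈ (tripleSystem P).part i, ∀ y ∈ (tripleSystem P).part j, ∀ z,
    zeroBracket P x (zeroBracket P y z) = zeroBracket P (zeroBracket P x y) z +
      sgn k (i * j) • zeroBracket P y (zeroBracket P x z) := hL.jacobi
  refine
    { isCompl := hL.isCompl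
      form_ne_zero := ?_
      form_even_odd := ?_
      form_odd_even := ?_
      form_symm := ?_
      form_alt := ?_
      triple_mem := fun a b c x hx y hy z hz => hmem _ _ _ (hmem _ _ _ hx _ hy) _ hz
      triple_skew := ?_
      triple_form := fun a b c x hx y hy z hz => tripleSystem_triple_form P hx hy hz
      triple_deriv := ?_
      form_deriv := ?_ }
  · intro h
    obtain ⟨b, hb⟩ := P.exists_symplecticBasis
    have := form_zeroVec hb (.inr 0) (.inr 1)
    rw [h] at this
    simp [zeroForm, planeForm] at this
    exact two_ne_zero_of_charP_three k this.symm
  · intro x hx y hy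
    rw [mem_part_zero] at hx
    rw [mem_part_one] at hy
    simp [tripleSystem_form, hx, hy]
  · intro x hx y hy
    rw [mem_part_one] at hx
    rw [mem_part_zero] at hy
    simp [tripleSystem_form, hx, hy]
  · intro x hx y hy
    rw [mem_part_zero] at hx hy
    simp only [tripleSystem_form, hx, hy, LinearMap.trace_mul_comm k x.1.1 y.1.1]
  · intro x hx
    rw [mem_part_one] at hx
    simp only [tripleSystem_form, hx, P.alt x.1.2]
    simp
  · intro a b c x hx y hy z _
    have := congrArg (fun t => zeroBracket P t z) (hskew a b x hx y hy)
    simp only [map_add, map_smul, LinearMap.add_apply, LinearMap.smul_apply, map_zero,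
      LinearMap.zero_apply] at this
    exact this
  · intro a b c d e x hx y hy u hu v hv w _
    simp only [tripleSystem_triple]
    have hD := hmem a b x hx y hy
    -- The element $[x,y]$ acts as a superderivation: the Jacobi identity is used once past $[u,v]$
    -- and once inside it.
    rw [hjac (a + b) (c + d) _ hD _ (hmem c d u hu v hv) w, hjac (a + b) c _ hD u hu v]
    simp only [map_add, map_smul, LinearMap.add_apply, LinearMap.smul_apply]
  · intro a b c d x hx y hy u hu v _
    simp only [tripleSystem_triple]
    have hD := hmem a b x hx y hy
    -- Invariance turns $(u|[D,v])$ into $([u,D]|v)$ for $D=[x,y]$, and skew-symmetry compares this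
    -- with $([D,u]|v)$.
    rw [← form_zeroBracket, eq_neg_of_add_eq_zero_left (hskew (a + b) c _ hD u hu)]
    simp

lemma range_zeroEquiv_inl :
    LinearMap.range ((zeroEquiv P).toLinearMap ∘ₗ LinearMap.inl k P.sp V) =
      (tripleSystem P).part 0 := by
  ext x
  rw [mem_part_zero]
  constructor
  · rintro ⟨s, rfl⟩
    rfl
  · intro h
    refine ⟨((zeroEquiv P).symm x).1, ?_⟩
    rw [LinearMap.comp_apply, LinearEquiv.coe_coe, ← LinearEquiv.eq_symm_apply]
    exact Prod.ext rfl h.symm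

lemma range_zeroEquiv_inr :
    LinearMap.range ((zeroEquiv P).toLinearMap ∘ₗ LinearMap.inr k P.sp V) =
      (tripleSystem P).part 1 := by
  ext x
  rw [mem_part_one]
  constructor
  · rintro ⟨s, rfl⟩
    rfl
  · intro h
    refine ⟨((zeroEquiv P).symm x).2, ?_⟩
    rw [LinearMap.comp_apply, LinearEquiv.coe_coe, ← LinearEquiv.eq_symm_apply]
    exact Prod.ext (Subtype.ext h.symm) rfl

lemma finrank_part_zero [CharP k 3] : Module.finrank k ((tripleSystem P).part 0) = 3 := by
  obtain ⟨b, hb⟩ := P.exists_symplecticBasis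
  have h2 := two_ne_zero_of_charP_three k
  rw [← range_zeroEquiv_inl, LinearMap.finrank_range_of_inj
    (f := (zeroEquiv P).toLinearMap ∘ₗ LinearMap.inl k P.sp V)
    ((zeroEquiv P).injective.comp LinearMap.inl_injective),
    Module.finrank_eq_card_basis (Module.Basis.mk
      (SymplecticPlane.gamVec_linearIndependent hb h2) (SymplecticPlane.gamVec_span hb h2))]
  simp

lemma finrank_part_one : Module.finrank k ((tripleSystem P).part 1) = 2 := by
  rw [← range_zeroEquiv_inr, LinearMap.finrank_range_of_inj
    (f := (zeroEquiv P).toLinearMap ∘ₗ LinearMap.inr k P.sp V)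
    ((zeroEquiv P).injective.comp LinearMap.inr_injective), P.finrank_eq]

/-! ### The inner derivations -/

/-- The centre of $T$ is zero: bracketing with $V$ recovers $2s$ from an even component $s$, and
bracketing with $\gamma_{0,1}$, an involution of $V$ up to the factor $2$, detects the odd
component. -/
lemma zeroBracket_injective [CharP k 3] : Function.Injective (zeroBracket P) := by
  obtain ⟨b, hb⟩ := P.exists_symplecticBasis
  have h2 := two_ne_zero_of_charP_three k
  rw [← LinearMap.ker_eq_bot, LinearMap.ker_eq_bot']
  intro x hx
  obtain ⟨⟨s, u⟩, rfl⟩ := (zeroEquiv P).surjective x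
  have hs : s = 0 := by
    ext v
    have := LinearMap.congr_fun hx (zeroEquiv P (0, v))
    rw [zeroBracket_zeroEquiv, LinearMap.zero_apply, LinearEquiv.map_eq_zero_iff] at this
    simpa [h2] using congrArg Prod.snd this
  have hu : u = 0 := by
    have := LinearMap.congr_fun hx (zeroEquiv P (P.gamVec b 1, 0))
    rw [zeroBracket_zeroEquiv, LinearMap.zero_apply, LinearEquiv.map_eq_zero_iff] at this
    have h1 : (P.gamVec b 1 : Module.End k V) u = 0 := by
      simpa [h2] using congrArg Prod.snd this
    have h3 : (P.gamVec b 1 : Module.End k V) ∘ₗ (P.gamVec b 1 : Module.End k V) =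
        LinearMap.id := by
      refine b.ext fun i => ?_
      simp only [LinearMap.comp_apply, SymplecticPlane.gamVec_apply hb, map_evalList]
      fin_cases i <;> simp [spAction]
    have h4 := LinearMap.congr_fun h3 u
    rw [LinearMap.comp_apply, h1, map_zero] at h4
    exact h4.symm
  rw [hs, hu]
  exact map_zero _

/-- The inner derivations are the maps $\mathrm{ad}[x,y]$, so the point is that $T$ is spanned by
brackets. -/
lemma range_zeroBracket [CharP k 3] : LinearMap.range (zeroBracket P) = (tripleSystem P).inder := by
  obtain ⟨b, hb⟩ := P.exists_symplecticBasis
  have h2 := two_ne_zero_of_charP_three k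
  refine le_antisymm ?_ (Submodule.span_le.2 ?_)
  · rw [LinearMap.range_eq_map, ← top_le_iff.1 (zeroVec_span P hb), Submodule.map_span,
      Submodule.span_le]
    rintro _ ⟨_, ⟨i, rfl⟩, rfl⟩
    -- The $\gamma_{i,j}$ come from pairs of odd vectors; $b_0$ and $b_1$ are eigenvectors of
    -- $\mathrm{ad}\,\gamma_{0,1}$ with eigenvalues $2$ and $-2$.
    have key : ∃ j l, ∃ c : k, zeroVec P b i =
        c • zeroBracket P (zeroVec P b j) (zeroVec P b l) := by
      simp only [zeroBracket_zeroVec hb]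
      rcases i with i | i <;> fin_cases i
      · exact ⟨.inr 0, .inr 0, -1, by simp [zeroTable, gamIndex]⟩
      · exact ⟨.inr 0, .inr 1, -1, by simp [zeroTable, gamIndex]⟩
      · exact ⟨.inr 1, .inr 1, -1, by simp [zeroTable, gamIndex]⟩
      · exact ⟨.inl 1, .inr 0, 2⁻¹, by simp [zeroTable, spAction, h2]⟩
      · exact ⟨.inl 1, .inr 1, -2⁻¹, by simp [zeroTable, spAction, h2]⟩
    obtain ⟨j, l, c, h⟩ := key
    rw [h, map_smul, ← tripleSystem_triple]
    exact Submodule.smul_mem _ _ ((tripleSystem P).triple_mem_inder (zeroVec P b j) (zeroVec P b l))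
  · rintro _ ⟨x, y, rfl⟩
    exact ⟨_, rfl⟩

/-- The identification of `B(4,2)^0` with its inner derivations. -/
def adEquiv [CharP k 3] : traceZero P ≃ₗ[k] (tripleSystem P).inder :=
  (LinearEquiv.ofInjective _ (zeroBracket_injective P)).trans
    (LinearEquiv.ofEq _ _ (range_zeroBracket P))

lemma coe_adEquiv [CharP k 3] (x : traceZero P) :
    (adEquiv P x : Module.End k (traceZero P)) = zeroBracket P x := rfl

end B42

/-! ## The Lie superalgebra of a triple system with the structure constants of `B(4,2)^0` -/

section Disjoint

variable {k : Type u} [Field k] {V : Type v} [AddCommGroup V] [Module k V]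
variable {T : Type w} [AddCommGroup T] [Module k T] {S : TripleSystem k T}

lemma disjoint_endPart (h : S.IsOrthosymplectic) {d : Module.End k T}
    (h0 : d ∈ endPart S.part 0) (h1 : d ∈ endPart S.part 1) : d = 0 := by
  have e0 := endProj_of_mem h.isCompl (i := 0) h0
  have e1 := endProj_of_mem h.isCompl (i := 0) h1
  simp only [if_true] at e0
  rw [← e0, e1]
  simp

/-- The parity projections of $T$, tensored with $V$, separate $V\otimes T_{\bar0}$ from $V\otimes
T_{\bar1}$ without a choice of basis. -/
lemma lTensor_parityProj_of_mem (h : S.IsOrthosymplectic) {i : ZMod 2} {t : V ⊗[k] T}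
    (ht : t ∈ LinearMap.range ((S.part i).subtype.lTensor V)) :
    (parityProj h.isCompl i).lTensor V t = t ∧ (parityProj h.isCompl (i + 1)).lTensor V t = 0 := by
  obtain ⟨t, rfl⟩ := ht
  induction t using TensorProduct.induction_on with
  | zero => simp
  | add t t' h1 h2 => simp only [map_add, h1.1, h1.2, h2.1, h2.2, add_zero, and_self]
  | tmul v x => simp [parityProj_of_mem h.isCompl x.2]

lemma disjoint_part_lieSuperalgebra (h : S.IsOrthosymplectic) (P : SymplecticPlane k V) :
    Disjoint ((S.lieSuperalgebra h P).part 0) ((S.lieSuperalgebra h P).part 1) := by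
  rw [Submodule.disjoint_def]
  rintro ⟨s, d, t⟩ ⟨-, hd0, ht0⟩ ⟨hs1, hd1, ht1⟩
  have hs : s = 0 := by simpa using hs1
  have hd : d = 0 := Subtype.ext (disjoint_endPart h hd0 hd1)
  -- Since $V$ is odd, the part of parity $i$ contains $V\otimes T_{i+1}$; this accounts for the
  -- shifted indices.
  have ht : t = 0 :=
    (lTensor_parityProj_of_mem h ht1).1.symm.trans (lTensor_parityProj_of_mem h ht0).2
  rw [hs, hd, ht]
  rfl

variable (h : S.IsOrthosymplectic) (P : SymplecticPlane k V)

lemma lieSuperalgebra_mul_apply (X Y : P.sp × S.inder × (V ⊗[k] T)) :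
    (S.lieSuperalgebra h P).mul X Y =
      (P.spBracket X.1 Y.1 + TripleSystem.tensorToSp h P X.2.2 Y.2.2,
        TripleSystem.inderBracket h X.2.1 Y.2.1 + TripleSystem.tensorToInder h P X.2.2 Y.2.2,
        TripleSystem.spAct P T X.1 Y.2.2 - TripleSystem.spAct P T Y.1 X.2.2
          + TripleSystem.inderAct V h X.2.1 Y.2.2 + TripleSystem.inderActRight V h X.2.2 Y.2.1) :=
  rfl

lemma lieSuperalgebra_mul_sp_sp (s t : P.sp) :
    (S.lieSuperalgebra h P).mul (s, 0, 0) (t, 0, 0) = (P.spBracket s t, 0, 0) := by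
  simp [lieSuperalgebra_mul_apply]

lemma lieSuperalgebra_mul_sp_der (s : P.sp) (d : S.inder) :
    (S.lieSuperalgebra h P).mul (s, 0, 0) (0, d, 0) = 0 := by
  simp [lieSuperalgebra_mul_apply]

lemma lieSuperalgebra_mul_der_sp (d : S.inder) (s : P.sp) :
    (S.lieSuperalgebra h P).mul (0, d, 0) (s, 0, 0) = 0 := by
  simp [lieSuperalgebra_mul_apply]

lemma lieSuperalgebra_mul_sp_tmul (s : P.sp) (v : V) (x : T) :
    (S.lieSuperalgebra h P).mul (s, 0, 0) (0, 0, v ⊗ₜ x) = (0, 0, s.1 v ⊗ₜ x) := by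
  have : TripleSystem.spAct P T s (v ⊗ₜ x) = s.1 v ⊗ₜ x := rfl
  simp [lieSuperalgebra_mul_apply, this]

lemma lieSuperalgebra_mul_tmul_sp (v : V) (x : T) (s : P.sp) :
    (S.lieSuperalgebra h P).mul (0, 0, v ⊗ₜ x) (s, 0, 0) = (0, 0, -(s.1 v ⊗ₜ x)) := by
  have : TripleSystem.spAct P T s (v ⊗ₜ x) = s.1 v ⊗ₜ x := rfl
  simp [lieSuperalgebra_mul_apply, this]

lemma lieSuperalgebra_mul_der_der (d e : S.inder) :
    (S.lieSuperalgebra h P).mul (0, d, 0) (0, e, 0) = (0, TripleSystem.inderBracket h d e, 0) := by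
  simp [lieSuperalgebra_mul_apply]

end Disjoint

namespace TripleSystem

variable {k : Type u} [Field k] {T : Type w} [AddCommGroup T] [Module k T]

/-- A basis of a triple system with the structure constants of `B(4,2)^0`. -/
structure Coordinates (S : TripleSystem k T) where
  /-- the basis -/
  basis : Module.Basis (Fin 3 ⊕ Fin 2) k T
  /-- the Lie superbracket of which the triple product is the iteration -/
  bracket : T →ₗ[k] T →ₗ[k] T
  /-- the adjoint representation -/
  ad : T ≃ₗ[k] S.inder
  basis_mem : ∀ i, basis i ∈ S.part (zeroParity i)
  form_basis : ∀ i j, S.form (basis i) (basis j) = (zeroForm i j : k)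
  bracket_basis : ∀ i j, bracket (basis i) (basis j) = evalList k basis (zeroTable i j)
  coe_ad : ∀ x, (ad x : Module.End k T) = bracket x
  triple_eq : ∀ x y, S.triple x y = bracket (bracket x y)
  bracket_mem : ∀ a b : ZMod 2, ∀ x ∈ S.part a, ∀ y ∈ S.part b, bracket x y ∈ S.part (a + b)
  jacobi : ∀ a b : ZMod 2, ∀ x ∈ S.part a, ∀ y ∈ S.part b, ∀ z,
    bracket x (bracket y z) = bracket (bracket x y) z + sgn k (a * b) • bracket y (bracket x z)

variable {S : TripleSystem k T} (B : S.Coordinates)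
variable {W : Type v} [AddCommGroup W] [Module k W] {Q : SymplecticPlane k W}

namespace Coordinates

lemma innerDer_eq (x y : T) : S.innerDer x y = B.ad (B.bracket x y) :=
  Subtype.ext ((B.triple_eq x y).trans (B.coe_ad _).symm)

lemma ad_mem {a : ZMod 2} {x : T} (hx : x ∈ S.part a) :
    (B.ad x : Module.End k T) ∈ endPart S.part a := by
  intro j y hy
  rw [B.coe_ad]
  exact B.bracket_mem a j x hx y hy

/-- The Jacobi identity says that $\mathrm{ad}$ is a homomorphism, so the bracket of
$\mathrm{inder}(T)$ is governed by `zeroTable`. -/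
lemma inderBracket_ad (h : S.IsOrthosymplectic) {a b : ZMod 2} {x y : T} (hx : x ∈ S.part a)
    (hy : y ∈ S.part b) : inderBracket h (B.ad x) (B.ad y) = B.ad (B.bracket x y) := by
  ext1
  change glBracket h.isCompl _ _ = _
  rw [glBracket_of_mem _ (B.ad_mem hx) (B.ad_mem hy)]
  simp only [B.coe_ad]
  refine LinearMap.ext fun z => ?_
  rw [LinearMap.sub_apply, LinearMap.smul_apply, Module.End.mul_apply, Module.End.mul_apply,
    sub_eq_iff_eq_add]
  exact B.jacobi a b x hx y hy z

variable (Q) in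
/-- The vectors of `g(T)` given by two vectors of the symplectic plane. -/
def fullVec (c : Fin 2 → W) : Fin 3 ⊕ (Fin 3 ⊕ Fin 2) ⊕ Fin 2 × (Fin 3 ⊕ Fin 2) →
    Q.sp × S.inder × (W ⊗[k] T) :=
  Sum.elim (fun i => (Q.gamVec c i, 0, 0))
    (Sum.elim (fun x => (0, B.ad (B.basis x), 0)) (fun p => (0, 0, c p.1 ⊗ₜ B.basis p.2)))

lemma fullVec_mem (h : S.IsOrthosymplectic) (c : Fin 2 → W)
    (i : Fin 3 ⊕ (Fin 3 ⊕ Fin 2) ⊕ Fin 2 × (Fin 3 ⊕ Fin 2)) :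
    B.fullVec Q c i ∈ (S.lieSuperalgebra h Q).part (fullParity i) := by
  rcases i with i | x | ⟨a, x⟩
  · exact ⟨by simp [fullParity, fullVec], Submodule.zero_mem _, Submodule.zero_mem _⟩
  · exact ⟨Submodule.zero_mem _, B.ad_mem (B.basis_mem x), Submodule.zero_mem _⟩
  · refine ⟨Submodule.zero_mem _, Submodule.zero_mem _, ?_⟩
    -- The parity of $c\otimes x$ is that of $x$ plus one, and the definition of the parts of
    -- $\mathfrak g(T)$ adds one again; the two shifts cancel.
    have hx : B.basis x ∈ S.part (fullParity (.inr (.inr (a, x))) + 1) := by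
      simpa [fullParity, add_assoc, CharTwo.add_self_eq_zero] using B.basis_mem x
    exact ⟨c a ⊗ₜ ⟨B.basis x, hx⟩, rfl⟩

variable {c : Module.Basis (Fin 2) k W}

section

variable (Q) (c : Fin 2 → W)

lemma evalList_fullVec_sp (l : List (ℤ × Fin 3)) :
    evalList k (fun i => B.fullVec Q c (.inl i)) l = (evalList k (Q.gamVec c) l, 0, 0) :=
  (map_evalList (LinearMap.inl k Q.sp (S.inder × (W ⊗[k] T))) _ l).symm

lemma evalList_fullVec_der (l : List (ℤ × (Fin 3 ⊕ Fin 2))) :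
    evalList k (fun x => B.fullVec Q c (.inr (.inl x))) l =
      (0, B.ad (evalList k B.basis l), 0) :=
  (map_evalList (LinearMap.inr k Q.sp (S.inder × (W ⊗[k] T)) ∘ₗ
    LinearMap.inl k S.inder (W ⊗[k] T) ∘ₗ B.ad.toLinearMap) _ l).symm

lemma evalList_fullVec_tmul_right (a : Fin 2) (l : List (ℤ × (Fin 3 ⊕ Fin 2))) :
    evalList k (fun x => B.fullVec Q c (.inr (.inr (a, x)))) l =
      (0, 0, c a ⊗ₜ evalList k B.basis l) :=
  (map_evalList (LinearMap.inr k Q.sp (S.inder × (W ⊗[k] T)) ∘ₗ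
    LinearMap.inr k S.inder (W ⊗[k] T) ∘ₗ TensorProduct.mk k W T (c a)) _ l).symm

lemma evalList_fullVec_tmul_left (x : Fin 3 ⊕ Fin 2) (l : List (ℤ × Fin 2)) :
    evalList k (fun a => B.fullVec Q c (.inr (.inr (a, x)))) l =
      (0, 0, evalList k c l ⊗ₜ B.basis x) :=
  (map_evalList (LinearMap.inr k Q.sp (S.inder × (W ⊗[k] T)) ∘ₗ
    LinearMap.inr k S.inder (W ⊗[k] T) ∘ₗ (TensorProduct.mk k W T).flip (B.basis x)) _ l).symm

end

variable (hc : ∀ i j, Q.form (c i) (c j) = (planeForm i j : k))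

/-- The basis of `g(T)` given by a symplectic basis of the plane. -/
def fullBasis (h2 : (2 : k) ≠ 0) :
    Module.Basis (Fin 3 ⊕ (Fin 3 ⊕ Fin 2) ⊕ Fin 2 × (Fin 3 ⊕ Fin 2)) k
      (Q.sp × S.inder × (W ⊗[k] T)) :=
  (Module.Basis.mk (SymplecticPlane.gamVec_linearIndependent hc h2)
    (SymplecticPlane.gamVec_span hc h2)).prod ((B.basis.map B.ad).prod (c.tensorProduct B.basis))

lemma coe_fullBasis (h2 : (2 : k) ≠ 0) : ⇑(B.fullBasis hc h2) = B.fullVec Q c := by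
  funext i
  rcases i with i | x | ⟨a, x⟩
  · simp [fullBasis, fullVec]
    rfl
  · simp [fullBasis, fullVec]
  · simp [fullBasis, fullVec]

include B hc

/-- Here the construction of $\mathfrak g(T)$ meets the table, one case for each pair of summands;
the later arguments about products use only the structure constants. -/
lemma mul_fullVec (h : S.IsOrthosymplectic)
    (i j : Fin 3 ⊕ (Fin 3 ⊕ Fin 2) ⊕ Fin 2 × (Fin 3 ⊕ Fin 2)) :
    (S.lieSuperalgebra h Q).mul (B.fullVec Q c i) (B.fullVec Q c j) =
      evalList k (B.fullVec Q c) (fullTable i j) := by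
  rcases i with i | x | ⟨a, x⟩ <;> rcases j with j | y | ⟨a', y⟩
  · rw [fullTable, evalList_reindexList, evalList_fullVec_sp,
      ← SymplecticPlane.spBracket_gamVec hc]
    exact lieSuperalgebra_mul_sp_sp h Q _ _
  · exact lieSuperalgebra_mul_sp_der h Q _ _
  · rw [fullTable, evalList_reindexList, evalList_fullVec_tmul_left,
      ← SymplecticPlane.gamVec_apply hc]
    exact lieSuperalgebra_mul_sp_tmul h Q _ _ _
  · exact lieSuperalgebra_mul_der_sp h Q _ _
  · rw [fullTable, evalList_reindexList, evalList_fullVec_der, ← B.bracket_basis,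
      ← B.inderBracket_ad h (B.basis_mem x) (B.basis_mem y)]
    exact lieSuperalgebra_mul_der_der h Q _ _
  · rw [fullTable, evalList_reindexList, evalList_fullVec_tmul_right, evalList_scaleList,
      ← B.bracket_basis]
    refine (lieSuperalgebra_mul_der h Q (c a') (B.basis_mem y) _
      (B.ad_mem (B.basis_mem x))).1.trans ?_
    rw [B.coe_ad, intCast_intSgn, TensorProduct.tmul_smul]
  · rw [fullTable, evalList_reindexList, evalList_fullVec_tmul_left, evalList_scaleList,
      ← SymplecticPlane.gamVec_apply hc]
    refine (lieSuperalgebra_mul_tmul_sp h Q _ _ _).trans ?_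
    rw [Int.cast_neg, Int.cast_one, neg_one_smul, TensorProduct.neg_tmul]
  · rw [fullTable, evalList_reindexList, evalList_fullVec_tmul_right, evalList_scaleList,
      ← B.bracket_basis]
    refine (lieSuperalgebra_mul_der h Q (c a) (B.basis_mem x) _
      (B.ad_mem (B.basis_mem y))).2.trans ?_
    rw [B.coe_ad, TensorProduct.tmul_smul, Int.cast_neg, Int.cast_mul, intCast_intSgn,
      intCast_intSgn, neg_smul, mul_smul]
    simp
  · rw [fullTable, evalList_dropZeros, evalList_cons, evalList_reindexList, evalList_fullVec_der,
      evalList_scaleList, ← B.bracket_basis, map_smul, ← B.innerDer_eq]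
    refine (lieSuperalgebra_mul_tmul h Q (c a) (c a') (B.basis_mem x) _).trans ?_
    rw [B.form_basis, hc, SymplecticPlane.gam_eq_gamVec]
    simp [fullVec, mul_smul]

theorem isLieSuperalgebra [CharP k 3] (h : S.IsOrthosymplectic) :
    IsLieSuperalgebra (S.lieSuperalgebra h Q) :=
  isLieTable_fullTable.isLieSuperalgebra (disjoint_part_lieSuperalgebra h Q)
    (B.fullVec_mem h c)
    (by rw [← B.coe_fullBasis hc (two_ne_zero_of_charP_three k), Module.Basis.span_eq])
    (B.mul_fullVec hc h)

end Coordinates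

end TripleSystem

/-- The structure constants of `B(4,2)^0`. -/
def B42.coordinates {k : Type u} [Field k] [CharP k 3] {V : Type v} [AddCommGroup V] [Module k V]
    {P : SymplecticPlane k V} {b : Module.Basis (Fin 2) k V}
    (hb : ∀ i j, P.form (b i) (b j) = (planeForm i j : k)) :
    (B42.tripleSystem P).Coordinates where
  basis := B42.zeroBasis hb (two_ne_zero_of_charP_three k)
  bracket := B42.zeroBracket P
  ad := B42.adEquiv P
  basis_mem i := by
    rw [B42.coe_zeroBasis]
    exact B42.zeroVec_mem P b i
  form_basis i j := by
    rw [B42.coe_zeroBasis]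
    exact B42.form_zeroVec hb i j
  bracket_basis i j := by
    rw [B42.coe_zeroBasis]
    exact B42.zeroBracket_zeroVec hb i j
  coe_ad := B42.coe_adEquiv P
  triple_eq _ _ := rfl
  bracket_mem := (B42.isLieSuperalgebra_zeroAlgebra P).mul_mem
  jacobi := (B42.isLieSuperalgebra_zeroAlgebra P).jacobi

/-! ## Contragredient Lie superalgebras -/

namespace Contragredient

variable {k : Type u} [Field k] {n : ℕ}

section Free

/-- Evaluation of nonassociative polynomials in a nonassociative algebra. -/
lemma exists_freeLift {G : Type v} [AddCommGroup G] [Module k G] (mul : G →ₗ[k] G →ₗ[k] G)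
    (g : Gen n → G) : ∃ φ : Free k n →ₗ[k] G,
      (∀ x y, φ (x * y) = mul (φ x) (φ y)) ∧ ∀ a, φ (gen a) = g a := by
  -- The bilinear product is made a local ring structure on $G$ so that the universal property of
  -- the free nonassociative algebra applies.
  let _ : NonUnitalNonAssocRing G :=
    { ‹AddCommGroup G› with
      mul := fun x y => mul x y
      left_distrib := fun x y z => map_add (mul x) y z
      right_distrib := fun x y z => LinearMap.map_add₂ mul x y z
      zero_mul := fun x => LinearMap.map_zero₂ mul x
      mul_zero := fun x => map_zero (mul x) }
  have : IsScalarTower k G G := ⟨fun a x y => LinearMap.map_smul₂ mul a x y⟩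
  have : SMulCommClass k G G := ⟨fun a x y => (map_smul (mul x) a y).symm⟩
  let φ := FreeNonUnitalNonAssocAlgebra.lift k g
  exact ⟨⟨⟨φ, map_add φ⟩, map_smul φ⟩, map_mul φ,
    fun a => FreeNonUnitalNonAssocAlgebra.lift_of_apply k g a⟩

lemma span_words :
    Submodule.span k (Set.range (MonoidAlgebra.ofMagma k (FreeMagma (Gen n)))) = ⊤ := by
  rw [eq_top_iff]
  rintro x -
  induction x using MonoidAlgebra.induction_linear with
  | zero => exact Submodule.zero_mem _
  | add x y hx hy => exact Submodule.add_mem _ hx hy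
  | single m a =>
    have : MonoidAlgebra.single m a = a • MonoidAlgebra.ofMagma k (FreeMagma (Gen n)) m := by simp
    rw [this]
    exact Submodule.smul_mem _ _ (Submodule.subset_span ⟨m, rfl⟩)

lemma iSup_freeDegreePart : ⨆ d, freeDegreePart (n := n) k d = ⊤ := by
  rw [eq_top_iff, ← span_words, Submodule.span_le]
  rintro _ ⟨m, rfl⟩
  exact Submodule.mem_iSup_of_mem (wordDegree m) (Submodule.subset_span ⟨m, rfl, rfl⟩)

lemma freeParityPart_sup (τ : Fin n → ZMod 2) : freeParityPart k τ 0 ⊔ freeParityPart k τ 1 = ⊤ := by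
  rw [eq_top_iff, ← span_words, Submodule.span_le]
  rintro _ ⟨m, rfl⟩
  have h : ∀ q : ZMod 2, q = 0 ∨ q = 1 := by decide
  rcases h (wordParity τ m) with h | h
  · exact Submodule.mem_sup_left (Submodule.subset_span ⟨m, h, rfl⟩)
  · exact Submodule.mem_sup_right (Submodule.subset_span ⟨m, h, rfl⟩)

end Free

/-! ### Triangular decomposition of the Lie superalgebra given by generators and relations. -/

section Tilde

variable (A : Matrix (Fin n) (Fin n) k) (τ : Fin n → ZMod 2)

/-- The value of a nonassociative word in `\tilde g(A,τ)`. -/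
def tildeWord (m : FreeMagma (Gen n)) : Tilde A τ :=
  (relIdeal A τ).mkQ (MonoidAlgebra.ofMagma k _ m)

lemma tildeMul_mk (x y : Free k n) :
    tildeMul A τ ((relIdeal A τ).mkQ x) ((relIdeal A τ).mkQ y) = (relIdeal A τ).mkQ (x * y) := rfl

lemma tildeMul_word (a b : FreeMagma (Gen n)) :
    tildeMul A τ (tildeWord A τ a) (tildeWord A τ b) = tildeWord A τ (a * b) := by
  rw [tildeWord, tildeWord, tildeMul_mk, ← map_mul]
  rfl

variable {A τ} in
lemma Relator.mk_eq_zero {x : Free k n} (hx : Relator A τ x) : (relIdeal A τ).mkQ x = 0 := by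
  rw [Submodule.mkQ_apply, Submodule.Quotient.mk_eq_zero, relIdeal, Submodule.mem_sInf]
  exact fun J hJ => hJ.2 x hx

lemma ofMagma_mem_freeParityPart (m : FreeMagma (Gen n)) :
    MonoidAlgebra.ofMagma k _ m ∈ freeParityPart k τ (wordParity τ m) :=
  Submodule.subset_span ⟨m, rfl, rfl⟩

/-- Words are homogeneous, so the signs are explicit; this is the reason for computing with words.
-/
lemma tildeWord_skew (a b : FreeMagma (Gen n)) : tildeMul A τ (tildeWord A τ a) (tildeWord A τ b) =
    -(sgn k (wordParity τ a * wordParity τ b)) • tildeMul A τ (tildeWord A τ b) (tildeWord A τ a) := by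
  have := (Relator.skew (A := A) (τ := τ) _ _ _ _ (ofMagma_mem_freeParityPart τ a)
    (ofMagma_mem_freeParityPart τ b)).mk_eq_zero
  rw [map_add, map_smul, ← tildeMul_mk, ← tildeMul_mk] at this
  rw [neg_smul]
  exact eq_neg_of_add_eq_zero_left this

lemma tildeWord_jacobi (a b : FreeMagma (Gen n)) (z : Tilde A τ) :
    tildeMul A τ (tildeWord A τ a) (tildeMul A τ (tildeWord A τ b) z) =
      tildeMul A τ (tildeMul A τ (tildeWord A τ a) (tildeWord A τ b)) z +
        sgn k (wordParity τ a * wordParity τ b) •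
          tildeMul A τ (tildeWord A τ b) (tildeMul A τ (tildeWord A τ a) z) := by
  obtain ⟨z, rfl⟩ := (relIdeal A τ).mkQ_surjective z
  have := (Relator.jacobi (A := A) (τ := τ) _ _ _ _ z (ofMagma_mem_freeParityPart τ a)
    (ofMagma_mem_freeParityPart τ b)).mk_eq_zero
  rw [map_sub, map_sub, map_smul] at this
  simp only [← tildeMul_mk] at this
  rw [sub_sub, sub_eq_zero] at this
  exact this

/-- The span of the values of the words of degree `d` with a given property. -/
def wordSpan (p : FreeMagma (Gen n) → Prop) (d : Fin n → ℤ) : Submodule k (Tilde A τ) :=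
  Submodule.span k {x | ∃ m, p m ∧ wordDegree m = d ∧ x = tildeWord A τ m}

variable {A τ} {p p' p'' : FreeMagma (Gen n) → Prop}

lemma tildeWord_mem {m : FreeMagma (Gen n)} (h : p m) :
    tildeWord A τ m ∈ wordSpan A τ p (wordDegree m) :=
  Submodule.subset_span ⟨m, h, rfl, rfl⟩

lemma wordSpan_mono (h : ∀ m, p m → p' m) (d : Fin n → ℤ) : wordSpan A τ p d ≤ wordSpan A τ p' d :=
  Submodule.span_mono fun _ ⟨m, hm, hd, hx⟩ => ⟨m, h m hm, hd, hx⟩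

lemma tildeMul_mem_wordSpan
    (h : ∀ a b, p a → p' b → tildeMul A τ (tildeWord A τ a) (tildeWord A τ b) ∈
      wordSpan A τ p'' (wordDegree a + wordDegree b)) {d d' : Fin n → ℤ} {x y : Tilde A τ}
    (hx : x ∈ wordSpan A τ p d) (hy : y ∈ wordSpan A τ p' d') :
    tildeMul A τ x y ∈ wordSpan A τ p'' (d + d') := by
  have : Submodule.map₂ (tildeMul A τ) (wordSpan A τ p d) (wordSpan A τ p' d') ≤
      wordSpan A τ p'' (d + d') := by
    rw [wordSpan, wordSpan, Submodule.map₂_span_span, Submodule.span_le]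
    rintro _ ⟨_, ⟨a, ha, rfl, rfl⟩, _, ⟨b, hb, rfl, rfl⟩, rfl⟩
    exact h a b ha hb
  exact this (Submodule.apply_mem_map₂ _ hx hy)

lemma tildeMul_mem_of_flip {a b : FreeMagma (Gen n)} {d : Fin n → ℤ}
    (h : tildeMul A τ (tildeWord A τ a) (tildeWord A τ b) ∈ wordSpan A τ p d) :
    tildeMul A τ (tildeWord A τ b) (tildeWord A τ a) ∈ wordSpan A τ p d := by
  rw [tildeWord_skew]
  exact Submodule.smul_mem _ _ h

/-- Words in the `e_i`. -/
def OnlyE : FreeMagma (Gen n) → Prop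
  | .of (.e _) => True
  | .of _ => False
  | .mul a b => OnlyE a ∧ OnlyE b

/-- Words in the `f_i`. -/
def OnlyF : FreeMagma (Gen n) → Prop
  | .of (.f _) => True
  | .of _ => False
  | .mul a b => OnlyF a ∧ OnlyF b

/-- The words `h_i`. -/
def IsH (m : FreeMagma (Gen n)) : Prop := ∃ i, m = .of (.h i)

variable (A τ) in
/-- The `h_i` act diagonally on the words. -/
lemma exists_tildeMul_h (i : Fin n) (m : FreeMagma (Gen n)) :
    ∃ c : k, tildeMul A τ (tildeWord A τ (.of (.h i))) (tildeWord A τ m) = c • tildeWord A τ m := by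
  induction m using FreeMagma.recOnMul with
  | ih1 g =>
    cases g with
    | e j =>
      refine ⟨A i j, ?_⟩
      have := (Relator.he (A := A) (τ := τ) i j).mk_eq_zero
      rw [map_sub, map_smul, ← tildeMul_mk] at this
      exact sub_eq_zero.1 this
    | f j =>
      refine ⟨-A i j, ?_⟩
      have := (Relator.hf (A := A) (τ := τ) i j).mk_eq_zero
      rw [map_add, map_smul, ← tildeMul_mk] at this
      rw [neg_smul]
      exact eq_neg_of_add_eq_zero_left this
    | h j =>
      refine ⟨0, ?_⟩
      have := (Relator.hh (A := A) (τ := τ) i j).mk_eq_zero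
      rw [← tildeMul_mk] at this
      rw [zero_smul]
      exact this
  | ih2 a b ha hb =>
    obtain ⟨s, hs⟩ := ha
    obtain ⟨t, ht⟩ := hb
    -- Weights add under products: $h_i$ is even, so the Jacobi identity carries no sign.
    refine ⟨s + t, ?_⟩
    rw [← tildeMul_word, tildeWord_jacobi, hs, ht]
    simp [wordParity, sgn, add_smul]

lemma tildeMul_h_mem {a m : FreeMagma (Gen n)} (ha : IsH a) (hm : p m) :
    tildeMul A τ (tildeWord A τ a) (tildeWord A τ m) ∈
      wordSpan A τ p (wordDegree a + wordDegree m) := by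
  obtain ⟨i, rfl⟩ := ha
  obtain ⟨c, hc⟩ := exists_tildeMul_h A τ i m
  rw [hc, show wordDegree (.of (.h i)) = (0 : Fin n → ℤ) from rfl, zero_add]
  exact Submodule.smul_mem _ _ (tildeWord_mem hm)

lemma tildeMul_mem_lower (a b : FreeMagma (Gen n)) (ha : OnlyF a ∨ IsH a) (hb : OnlyF b ∨ IsH b) :
    tildeMul A τ (tildeWord A τ a) (tildeWord A τ b) ∈
      wordSpan A τ (fun m => OnlyF m ∨ IsH m) (wordDegree a + wordDegree b) := by
  rcases ha with ha | ha
  · rcases hb with hb' | hb'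
    · rw [tildeMul_word]
      exact tildeWord_mem (m := a * b) (Or.inl ⟨ha, hb'⟩)
    · refine tildeMul_mem_of_flip ?_
      rw [add_comm]
      exact tildeMul_h_mem hb' (Or.inl ha)
  · exact tildeMul_h_mem ha hb

/-- Induction on the word: $[e_i,f_j]=\delta_{ij}h_i$ at the start, then the Jacobi identity.
Allowing the $h_i$ in the target is what lets the induction close, since they normalise the words in
the $f_j$. -/
lemma tildeMul_e_lower (i : Fin n) (m : FreeMagma (Gen n)) (hm : OnlyF m) :
    tildeMul A τ (tildeWord A τ (.of (.e i))) (tildeWord A τ m) ∈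
      wordSpan A τ (fun m => OnlyF m ∨ IsH m) (Pi.single i 1 + wordDegree m) := by
  induction m using FreeMagma.recOnMul with
  | ih1 g =>
    cases g with
    | e j => exact hm.elim
    | h j => exact hm.elim
    | f j =>
      have := (Relator.ef (A := A) (τ := τ) i j).mk_eq_zero
      rw [map_sub, ← tildeMul_mk, sub_eq_zero] at this
      change tildeMul A τ (tildeWord A τ (.of (.e i))) (tildeWord A τ (.of (.f j))) = _ at this
      rw [this]
      split_ifs with hij
      · subst hij
        have h0 : Pi.single i 1 + wordDegree (.of (.f i)) =
            wordDegree (.of (.h i) : FreeMagma (Gen n)) := by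
          simp [wordDegree]
        rw [h0]
        exact tildeWord_mem (m := .of (.h i)) (Or.inr ⟨i, rfl⟩)
      · rw [map_zero]
        exact Submodule.zero_mem _
  | ih2 a b ha hb =>
    have hb' : tildeWord A τ b ∈ wordSpan A τ (fun m => OnlyF m ∨ IsH m) (wordDegree b) :=
      tildeWord_mem (Or.inl hm.2)
    have ha' : tildeWord A τ a ∈ wordSpan A τ (fun m => OnlyF m ∨ IsH m) (wordDegree a) :=
      tildeWord_mem (Or.inl hm.1)
    rw [← tildeMul_word, tildeWord_jacobi]
    refine Submodule.add_mem _ ?_ (Submodule.smul_mem _ _ ?_)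
    · have := tildeMul_mem_wordSpan tildeMul_mem_lower (ha hm.1) hb'
      rwa [add_assoc] at this
    · have := tildeMul_mem_wordSpan tildeMul_mem_lower ha' (hb hm.2)
      rwa [add_left_comm] at this

/-- The words of which `\tilde g(A,τ)` is the span. -/
def Standard (m : FreeMagma (Gen n)) : Prop := OnlyE m ∨ OnlyF m ∨ IsH m

lemma tildeMul_e_standard (i : Fin n) (m : FreeMagma (Gen n)) (hm : Standard m) :
    tildeMul A τ (tildeWord A τ (.of (.e i))) (tildeWord A τ m) ∈
      wordSpan A τ Standard (Pi.single i 1 + wordDegree m) := by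
  rcases hm with hm | hm | hm
  · have h0 : Pi.single i 1 + wordDegree m = wordDegree (.of (.e i) * m) := rfl
    have h : Standard (.of (.e i) * m) := Or.inl ⟨trivial, hm⟩
    rw [tildeMul_word, h0]
    exact tildeWord_mem h
  · exact wordSpan_mono (fun _ => Or.inr) _ (tildeMul_e_lower i m hm)
  · refine tildeMul_mem_of_flip ?_
    have h0 : (Pi.single i 1 : Fin n → ℤ) = wordDegree (.of (.e i)) := rfl
    rw [add_comm, h0]
    have h : Standard (.of (.e i) : FreeMagma (Gen n)) := Or.inl trivial
    exact tildeMul_h_mem hm h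

/-- The action of a product $[a,b]$ is the supercommutator of the actions of $a$ and $b$.
Quantifying over the whole span makes the induction hypotheses composable. -/
lemma tildeMul_onlyE_standard (m : FreeMagma (Gen n)) (hm : OnlyE m) :
    ∀ (d : Fin n → ℤ), ∀ y ∈ wordSpan A τ Standard d,
      tildeMul A τ (tildeWord A τ m) y ∈ wordSpan A τ Standard (wordDegree m + d) := by
  induction m using FreeMagma.recOnMul with
  | ih1 g =>
    cases g with
    | f j => exact hm.elim
    | h j => exact hm.elim
    | e j =>
      intro d y hy
      refine tildeMul_mem_wordSpan (p := fun m => m = .of (.e j)) ?_ (tildeWord_mem rfl) hy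
      rintro _ b rfl hb
      exact tildeMul_e_standard j b hb
  | ih2 a b ha hb =>
    intro d y hy
    have h := tildeWord_jacobi A τ a b y
    rw [tildeMul_word] at h
    rw [← sub_eq_iff_eq_add] at h
    rw [← h]
    change _ ∈ wordSpan A τ Standard (wordDegree a + wordDegree b + d)
    refine Submodule.sub_mem _ ?_ (Submodule.smul_mem _ _ ?_)
    · rw [add_assoc]
      exact ha hm.1 _ _ (hb hm.2 _ _ hy)
    · rw [add_assoc, add_left_comm]
      exact hb hm.2 _ _ (ha hm.1 _ _ hy)

lemma tildeMul_standard (a b : FreeMagma (Gen n)) (ha : Standard a) (hb : Standard b) :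
    tildeMul A τ (tildeWord A τ a) (tildeWord A τ b) ∈
      wordSpan A τ Standard (wordDegree a + wordDegree b) := by
  rcases ha with ha | ha
  · exact tildeMul_onlyE_standard a ha _ _ (tildeWord_mem hb)
  · rcases hb with hb | hb
    · refine tildeMul_mem_of_flip ?_
      rw [add_comm]
      exact tildeMul_onlyE_standard b hb _ _ (tildeWord_mem (Or.inr ha))
    · exact wordSpan_mono (fun _ => Or.inr) _ (tildeMul_mem_lower a b ha hb)

-- The span of the words in the $e_i$, the words in the $f_i$ and the $h_i$ contains the generators
-- and is closed under the bracket. Directness of the sum is not needed.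
variable (A τ) in
lemma tildeWord_mem_standard (m : FreeMagma (Gen n)) :
    tildeWord A τ m ∈ wordSpan A τ Standard (wordDegree m) := by
  induction m using FreeMagma.recOnMul with
  | ih1 g =>
    refine tildeWord_mem ?_
    cases g with
    | e i => exact Or.inl trivial
    | f i => exact Or.inr (Or.inl trivial)
    | h i => exact Or.inr (Or.inr ⟨i, rfl⟩)
  | ih2 a b ha hb =>
    rw [← tildeMul_word]
    exact tildeMul_mem_wordSpan tildeMul_standard ha hb

/-- The height, together with its negative counterpart for the $f_i$, excludes all standard words of
degree $0$ other than the $h_i$. -/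
lemma sum_wordDegree_pos {m : FreeMagma (Gen n)} (hm : OnlyE m) : 0 < ∑ i, wordDegree m i := by
  induction m using FreeMagma.recOnMul with
  | ih1 g =>
    cases g with
    | f j => exact hm.elim
    | h j => exact hm.elim
    | e j => simp [wordDegree]
  | ih2 a b ha hb =>
    change 0 < ∑ i, (wordDegree a i + wordDegree b i)
    rw [Finset.sum_add_distrib]
    exact add_pos (ha hm.1) (hb hm.2)

lemma sum_wordDegree_neg {m : FreeMagma (Gen n)} (hm : OnlyF m) : ∑ i, wordDegree m i < 0 := by
  induction m using FreeMagma.recOnMul with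
  | ih1 g =>
    cases g with
    | e j => exact hm.elim
    | h j => exact hm.elim
    | f j => simp [wordDegree]
  | ih2 a b ha hb =>
    change ∑ i, (wordDegree a i + wordDegree b i) < 0
    rw [Finset.sum_add_distrib]
    exact add_neg (ha hm.1) (hb hm.2)

variable (A τ) in
/-- The homogeneous component of degree `0` of `\tilde g(A,τ)` is spanned by the `h_i`. -/
lemma tildeDegreePart_zero_le : tildeDegreePart A τ 0 ≤ tildeCartan A τ := by
  rw [tildeDegreePart, freeDegreePart, Submodule.map_span, Submodule.span_le]
  rintro _ ⟨_, ⟨m, hm, rfl⟩, rfl⟩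
  have := tildeWord_mem_standard A τ m
  rw [hm] at this
  refine Submodule.span_le.2 ?_ this
  rintro _ ⟨a, ha | ha | ⟨i, rfl⟩, h0, rfl⟩
  · simpa [h0] using sum_wordDegree_pos ha
  · simpa [h0] using sum_wordDegree_neg ha
  · exact Submodule.subset_span ⟨i, rfl⟩

end Tilde

end Contragredient

/-! ### Recognition of a contragredient Lie superalgebra from a graded model. -/

namespace Contragredient

variable {k : Type u} [Field k] {n : ℕ} {G : Type v} [AddCommGroup G] [Module k G]

/-- A graded Lie superalgebra with generators satisfying the relations of `\tilde g(A,τ)` in which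
the opposite homogeneous components are in duality. -/
structure IsGradedModel (A : Matrix (Fin n) (Fin n) k) (τ : Fin n → ZMod 2) (S : SuperAlgebra k G)
    (gr : (Fin n → ℤ) → Submodule k G) (e f h : Fin n → G) : Prop where
  lie : IsLieSuperalgebra S
  e_mem : ∀ i, e i ∈ S.part (τ i)
  f_mem : ∀ i, f i ∈ S.part (τ i)
  h_mem : ∀ i, h i ∈ S.part 0
  mul_hh : ∀ i j, S.mul (h i) (h j) = 0
  mul_he : ∀ i j, S.mul (h i) (e j) = A i j • e j
  mul_hf : ∀ i j, S.mul (h i) (f j) = -A i j • f j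
  mul_ef : ∀ i j, S.mul (e i) (f j) = if i = j then h i else 0
  h_indep : LinearIndependent k h
  gr_indep : iSupIndep gr
  gr_sup : ⨆ d, gr d = ⊤
  gr_mul : ∀ d d', ∀ x ∈ gr d, ∀ y ∈ gr d', S.mul x y ∈ gr (d + d')
  e_gr : ∀ i, e i ∈ gr (Pi.single i 1)
  f_gr : ∀ i, f i ∈ gr (-Pi.single i 1)
  h_gr : ∀ i, h i ∈ gr 0
  -- Generation in graded form: `gr` lies below every family of subspaces that contains the
  -- generators in their degrees and is compatible with the product.
  generated : ∀ R : (Fin n → ℤ) → Submodule k G, (∀ i, e i ∈ R (Pi.single i 1)) →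
    (∀ i, f i ∈ R (-Pi.single i 1)) → (∀ i, h i ∈ R 0) →
    (∀ d d', ∀ x ∈ R d, ∀ y ∈ R d', S.mul x y ∈ R (d + d')) → ∀ d, gr d ≤ R d
  -- A nonzero element of degree $d\ne0$ has a nonzero bracket, necessarily of degree $0$, with some
  -- element of degree $-d$.
  nondegenerate : ∀ d, d ≠ 0 → ∀ x ∈ gr d, (∀ y ∈ gr (-d), S.mul y x = 0) → x = 0

namespace IsGradedModel

variable {A : Matrix (Fin n) (Fin n) k} {τ : Fin n → ZMod 2} {S : SuperAlgebra k G}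
  {gr : (Fin n → ℤ) → Submodule k G} {e f h : Fin n → G}

/-- The image of a word under a homomorphism. -/
lemma map_mem_of_words {φ : Free k n →ₗ[k] G} (hφ : ∀ x y, φ (x * y) = S.mul (φ x) (φ y))
    {ι : Type*} [Add ι] {R : ι → Submodule k G} {deg : FreeMagma (Gen n) → ι}
    (hgen : ∀ a, φ (gen a) ∈ R (deg (.of a))) (hdeg : ∀ a b, deg (a * b) = deg a + deg b)
    (hmul : ∀ d d', ∀ x ∈ R d, ∀ y ∈ R d', S.mul x y ∈ R (d + d')) (m : FreeMagma (Gen n)) :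
    φ (MonoidAlgebra.ofMagma k _ m) ∈ R (deg m) := by
  induction m using FreeMagma.recOnMul with
  | ih1 g => exact hgen g
  | ih2 a b ha hb =>
    rw [map_mul, hφ, hdeg]
    exact hmul _ _ _ ha _ hb

/-- Evaluation of nonassociative polynomials at the generators of the model kills the relators. That
the homogeneous components are mapped onto those of the model is the generation hypothesis. -/
theorem exists_hom (H : IsGradedModel A τ S gr e f h) : ∃ Φ : Tilde A τ →ₗ[k] G,
    (∀ x y, Φ (tildeMul A τ x y) = S.mul (Φ x) (Φ y)) ∧
    (∀ i, Φ ((relIdeal A τ).mkQ (gen (.h i))) = h i) ∧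
    (∀ d, (tildeDegreePart A τ d).map Φ = gr d) ∧
    (∀ i, ((freeParityPart k τ i).map (relIdeal A τ).mkQ).map Φ = S.part i) := by
  obtain ⟨φ, hφ, hgen⟩ := exists_freeLift (n := n) S.mul
    (fun a => match a with | .e i => e i | .f i => f i | .h i => h i)
  have hdeg : ∀ d, (freeDegreePart k d).map φ ≤ gr d := by
    intro d
    rw [freeDegreePart, Submodule.map_span, Submodule.span_le]
    rintro _ ⟨_, ⟨m, rfl, rfl⟩, rfl⟩
    refine map_mem_of_words hφ (R := gr) (deg := wordDegree) ?_ (fun _ _ => rfl) H.gr_mul m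
    rintro (i | i | i) <;> rw [hgen]
    exacts [H.e_gr i, H.f_gr i, H.h_gr i]
  have hpar : ∀ i, (freeParityPart k τ i).map φ ≤ S.part i := by
    intro d
    rw [freeParityPart, Submodule.map_span, Submodule.span_le]
    rintro _ ⟨_, ⟨m, rfl, rfl⟩, rfl⟩
    refine map_mem_of_words hφ (R := S.part) (deg := wordParity τ) ?_ (fun _ _ => rfl)
      H.lie.mul_mem m
    rintro (i | i | i) <;> rw [hgen]
    exacts [H.e_mem i, H.f_mem i, H.h_mem i]
  -- Generation is applied to the images of the homogeneous components themselves.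
  have hgen' : ∀ d, gr d ≤ (freeDegreePart k d).map φ := by
    have hw : ∀ a : Gen n, gen a ∈ freeDegreePart k (wordDegree (.of a)) :=
      fun a => Submodule.subset_span ⟨.of a, rfl, rfl⟩
    refine H.generated _ (fun i => ⟨_, hw (.e i), hgen _⟩) (fun i => ⟨_, hw (.f i), hgen _⟩)
      (fun i => ⟨_, hw (.h i), hgen _⟩) ?_
    rintro d d' _ ⟨x, hx, rfl⟩ _ ⟨y, hy, rfl⟩
    refine ⟨x * y, ?_, hφ x y⟩
    have : Submodule.map₂ (freeMul k n) (freeDegreePart k d) (freeDegreePart k d') ≤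
        freeDegreePart k (d + d') := by
      rw [freeDegreePart, freeDegreePart, Submodule.map₂_span_span, Submodule.span_le]
      rintro _ ⟨_, ⟨a, rfl, rfl⟩, _, ⟨b, rfl, rfl⟩, rfl⟩
      exact Submodule.subset_span ⟨a * b, rfl, (map_mul _ a b).symm⟩
    exact this (Submodule.apply_mem_map₂ _ hx hy)
  have hker : relIdeal A τ ≤ LinearMap.ker φ := by
    refine sInf_le ⟨?_, ?_⟩
    · intro x y hy
      rw [LinearMap.mem_ker] at hy
      constructor
      · change φ (x * y) = 0
        rw [hφ, hy, map_zero]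
      · change φ (y * x) = 0
        rw [hφ, hy, LinearMap.map_zero₂]
    · intro x hx
      rw [LinearMap.mem_ker]
      have hm : ∀ {i x}, x ∈ freeParityPart k τ i → φ x ∈ S.part i :=
        fun hx => hpar _ ⟨_, hx, rfl⟩
      cases hx with
      | hh i j => rw [hφ, hgen, hgen, H.mul_hh]
      | he i j => rw [map_sub, hφ, map_smul, hgen, hgen, H.mul_he, sub_self]
      | hf i j => rw [map_add, hφ, map_smul, hgen, hgen, H.mul_hf, neg_smul, neg_add_cancel]
      | ef i j =>
        rw [map_sub, hφ, hgen, hgen, H.mul_ef]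
        split_ifs
        · rw [hgen, sub_self]
        · rw [map_zero, sub_self]
      | skew i j x y hx hy => simpa [hφ] using H.lie.skew i j _ (hm hx) _ (hm hy)
      | jacobi i j x y z hx hy =>
        rw [map_sub, map_sub, map_smul]
        simp only [hφ]
        rw [H.lie.jacobi i j _ (hm hx) _ (hm hy)]
        abel
      | cube x hx => rw [hφ, hφ, H.lie.cube _ (hm hx)]
  have hmap : ∀ N : Submodule k (Free k n), (N.map (relIdeal A τ).mkQ).map
      ((relIdeal A τ).liftQ φ hker) = N.map φ := by
    intro N
    rw [← Submodule.map_comp, Submodule.liftQ_mkQ]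
  refine ⟨(relIdeal A τ).liftQ φ hker, ?_, fun i => hgen (.h i), ?_, ?_⟩
  · intro x y
    obtain ⟨x, rfl⟩ := (relIdeal A τ).mkQ_surjective x
    obtain ⟨y, rfl⟩ := (relIdeal A τ).mkQ_surjective y
    exact hφ x y
  · intro d
    rw [tildeDegreePart, hmap]
    exact le_antisymm (hdeg d) (hgen' d)
  · intro i
    rw [hmap]
    -- The images of the two parity parts lie in the parts of the model and add up to the whole
    -- space, by surjectivity.
    refine eq_of_le_of_sup_eq_top (sub := fun i => (freeParityPart k τ i).map φ)
      H.lie.isCompl.disjoint hpar ?_ i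
    rw [← Submodule.map_sup, freeParityPart_sup, ← iSup_freeDegreePart, Submodule.map_iSup,
      eq_top_iff, ← H.gr_sup]
    exact iSup_mono hgen'

lemma iSup_tildeDegreePart : ⨆ d, tildeDegreePart A τ d = ⊤ := by
  simp only [tildeDegreePart]
  rw [← Submodule.map_iSup, iSup_freeDegreePart, Submodule.map_top, Submodule.range_mkQ]

lemma tildeMul_mem_tildeDegreePart {d d' : Fin n → ℤ} {x y : Tilde A τ}
    (hx : x ∈ tildeDegreePart A τ d) (hy : y ∈ tildeDegreePart A τ d') :
    tildeMul A τ x y ∈ tildeDegreePart A τ (d + d') := by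
  have : ∀ d, tildeDegreePart A τ d = wordSpan A τ (fun _ => True) d := by
    intro d
    rw [tildeDegreePart, freeDegreePart, Submodule.map_span, wordSpan]
    congr 1
    ext z
    constructor
    · rintro ⟨_, ⟨m, hm, rfl⟩, rfl⟩
      exact ⟨m, trivial, hm, rfl⟩
    · rintro ⟨m, -, hm, rfl⟩
      exact ⟨_, ⟨m, hm, rfl⟩, rfl⟩
  rw [this] at hx hy ⊢
  refine tildeMul_mem_wordSpan (fun a b _ _ => ?_) hx hy
  rw [tildeMul_word]
  exact tildeWord_mem (m := a * b) trivial

/-- The kernel of the canonical homomorphism from `\tilde g(A,τ)` is the ideal `r`. -/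
lemma maxIdeal_eq_ker (H : IsGradedModel A τ S gr e f h) {Φ : Tilde A τ →ₗ[k] G}
    (hΦ : ∀ x y, Φ (tildeMul A τ x y) = S.mul (Φ x) (Φ y))
    (hh : ∀ i, Φ ((relIdeal A τ).mkQ (gen (.h i))) = h i)
    (hgr : ∀ d, (tildeDegreePart A τ d).map Φ = gr d) :
    maxIdeal A τ = LinearMap.ker Φ := by
  have hmem : ∀ {d x}, x ∈ tildeDegreePart A τ d → Φ x ∈ gr d := fun hx => hgr _ ▸ ⟨_, hx, rfl⟩
  refine le_antisymm (sSup_le ?_) (le_sSup ⟨?_, ?_, ?_⟩)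
  · rintro J ⟨hJ, hJgr, hJh⟩
    -- The triangular decomposition enters here: degree $0$ is contained in the span of the $h_i$,
    -- which $J$ meets trivially.
    have h0 : ∀ x ∈ J ⊓ tildeDegreePart A τ 0, x = 0 := by
      rintro x ⟨hx, hx0⟩
      have : x ∈ J ⊓ tildeCartan A τ := ⟨hx, tildeDegreePart_zero_le A τ hx0⟩
      rwa [hJh, Submodule.mem_bot] at this
    rw [hJgr]
    refine iSup_le fun d => ?_
    rintro x ⟨hx, hxd⟩
    rw [LinearMap.mem_ker]
    by_cases hd : d = 0
    · subst hd
      rw [h0 x ⟨hx, hxd⟩, map_zero]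
    -- Bracketing $x\in J$ of degree $d$ with degree $-d$ lands in the zero component of $J$ of
    -- degree $0$, so nondegeneracy kills $\Phi(x)$.
    · refine H.nondegenerate d hd _ (hmem hxd) fun y hy => ?_
      rw [← hgr] at hy
      obtain ⟨y, hy, rfl⟩ := hy
      have : tildeMul A τ y x ∈ tildeDegreePart A τ (-d + d) := tildeMul_mem_tildeDegreePart hy hxd
      rw [neg_add_cancel] at this
      rw [← hΦ, h0 _ ⟨(hJ y x hx).1, this⟩, map_zero]
  · intro x y hy
    rw [LinearMap.mem_ker] at hy
    constructor
    · rw [LinearMap.mem_ker, hΦ, hy, map_zero]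
    · rw [LinearMap.mem_ker, hΦ, hy, LinearMap.map_zero₂]
  -- The kernel is graded: the images of the components of $x$ lie in independent subspaces and sum
  -- to zero, so each vanishes.
  · refine le_antisymm (fun x hx => ?_) (iSup_le fun d => inf_le_left)
    have hx' : x ∈ ⨆ d, tildeDegreePart A τ d := iSup_tildeDegreePart (A := A) (τ := τ) ▸ Submodule.mem_top
    obtain ⟨c, hc, rfl⟩ := (Submodule.mem_iSup_iff_exists_finsupp _ _).1 hx'
    rw [LinearMap.mem_ker, Finsupp.sum, map_sum] at hx
    have hz := (iSupIndep_iff_finsetSum_eq_zero_imp_eq_zero gr).1 H.gr_indep c.support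
      (fun d => Φ (c d)) (fun d _ => hmem (hc d)) hx
    exact Submodule.sum_mem _ fun d hd => Submodule.mem_iSup_of_mem d ⟨hz d hd, hc d⟩
  -- The kernel meets the Cartan subspace trivially because the images of the $h_i$ are independent.
  · rw [Submodule.eq_bot_iff]
    rintro x ⟨hx, hxc⟩
    rw [tildeCartan] at hxc
    obtain ⟨c, rfl⟩ := (Submodule.mem_span_range_iff_exists_fun k).1 hxc
    have hx' : ∑ i, c i • h i = 0 := by
      rw [SetLike.mem_coe, LinearMap.mem_ker] at hx
      simpa only [map_sum, map_smul, hh] using hx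
    have := Fintype.linearIndependent_iff.1 H.h_indep c hx'
    simp [this]

/-- A graded model of a Cartan matrix is isomorphic to the contragredient Lie superalgebra. -/
theorem isIsomorphic (H : IsGradedModel A τ S gr e f h) :
    S.IsIsomorphic (lieSuperalgebra A τ) := by
  obtain ⟨Φ, hΦ, hh, hgr, hpar⟩ := H.exists_hom
  have hker := H.maxIdeal_eq_ker hΦ hh hgr
  have hsurj : Function.Surjective Φ := by
    rw [← LinearMap.range_eq_top, LinearMap.range_eq_map, ← iSup_tildeDegreePart,
      Submodule.map_iSup, ← H.gr_sup]
    simp only [hgr]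
  let E : Carrier A τ ≃ₗ[k] G :=
    (Submodule.quotEquivOfEq _ _ hker).trans (Φ.quotKerEquivOfSurjective hsurj)
  have hE : ∀ x, E ((maxIdeal A τ).mkQ x) = Φ x := fun x => rfl
  refine ⟨E.symm, fun i => ?_, fun x y => ?_⟩
  · change _ = ((freeParityPart k τ i).map (relIdeal A τ).mkQ).map (maxIdeal A τ).mkQ
    rw [← hpar i]
    ext z
    constructor
    · rintro ⟨_, ⟨x, hx, rfl⟩, rfl⟩
      refine ⟨x, hx, ?_⟩
      rw [← hE]
      exact (E.symm_apply_apply _).symm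
    · rintro ⟨x, hx, rfl⟩
      refine ⟨Φ x, ⟨x, hx, rfl⟩, ?_⟩
      rw [← hE]
      exact E.symm_apply_apply _
  · rw [LinearEquiv.symm_apply_eq]
    obtain ⟨x, rfl⟩ := hsurj x
    obtain ⟨y, rfl⟩ := hsurj y
    rw [← hE x, ← hE y, E.symm_apply_apply, E.symm_apply_apply, hE, hE]
    exact (hΦ x y).symm

end IsGradedModel
end Contragredient

/-! ## The isomorphism with `br(2;3)` -/

/-- The degrees of the basis of `g(T)` in terms of the simple roots of `br(2;3)`. -/
def fullDegree : Fin 3 ⊕ (Fin 3 ⊕ Fin 2) ⊕ Fin 2 × (Fin 3 ⊕ Fin 2) → Fin 2 → ℤ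
  | .inl i => ![![-2, 0, 2] i, ![-4, 0, 4] i]
  | .inr (.inl (.inl i)) => ![0, ![-2, 0, 2] i]
  | .inr (.inl (.inr i)) => ![0, ![-1, 1] i]
  | .inr (.inr (a, .inl i)) => ![![-1, 1] a, ![-2, 0, 2] i + ![-2, 2] a]
  | .inr (.inr (a, .inr i)) => ![![-1, 1] a, ![-1, 1] i + ![-2, 2] a]

/-- The positive generators. -/
def generatorE : Fin 2 → List (ℤ × (Fin 3 ⊕ (Fin 3 ⊕ Fin 2) ⊕ Fin 2 × (Fin 3 ⊕ Fin 2))) :=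
  ![[(1, .inr (.inr (1, .inl 0)))], [(1, .inr (.inl (.inr 1)))]]

/-- The negative generators. -/
def generatorF : Fin 2 → List (ℤ × (Fin 3 ⊕ (Fin 3 ⊕ Fin 2) ⊕ Fin 2 × (Fin 3 ⊕ Fin 2))) :=
  ![[(1, .inr (.inr (0, .inl 2)))], [(-1, .inr (.inl (.inr 0)))]]

/-- The basis of the Cartan subalgebra. -/
def generatorH : Fin 2 → List (ℤ × (Fin 3 ⊕ (Fin 3 ⊕ Fin 2) ⊕ Fin 2 × (Fin 3 ⊕ Fin 2))) :=
  ![[(1, .inl 1), (-1, .inr (.inl (.inl 1)))], [(1, .inr (.inl (.inl 1)))]]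

/-- Every listed index is tested, whatever its coefficient; this is why `fullTable` discards the
terms with coefficient $0$, which could sit in a wrong degree. -/
lemma fullTable_degree (i j : Fin 3 ⊕ (Fin 3 ⊕ Fin 2) ⊕ Fin 2 × (Fin 3 ⊕ Fin 2)) :
    ∀ q ∈ fullTable i j, fullDegree q.2 = fullDegree i + fullDegree j := by
  revert i j
  decide +kernel

/-- The root spaces are lines: outside degree $0$ a degree determines its basis vector. -/
lemma fullDegree_injOn (i j : Fin 3 ⊕ (Fin 3 ⊕ Fin 2) ⊕ Fin 2 × (Fin 3 ⊕ Fin 2)) :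
    fullDegree i ≠ 0 → fullDegree j = fullDegree i → j = i := by
  have h : ∀ i j, fullDegree i = 0 ∨ fullDegree j ≠ fullDegree i ∨ j = i := by decide +kernel
  exact fun hi hj => ((h i j).resolve_left hi).resolve_left (not_not.2 hj)

/-- With one-dimensional root spaces, nondegeneracy amounts to one structure constant prime to $3$
for each root. -/
lemma exists_opposite (i : Fin 3 ⊕ (Fin 3 ⊕ Fin 2) ⊕ Fin 2 × (Fin 3 ⊕ Fin 2)) :
    fullDegree i ≠ 0 → ∃ j, fullDegree j = -fullDegree i ∧
      ∃ l, ¬coeffList (fullTable j i) l % 3 = 0 := by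
  revert i
  decide +kernel

/-! ### The root grading of $\mathfrak g(T)$ and its Chevalley generators. -/

namespace TripleSystem.Coordinates

variable {k : Type u} [Field k] {T : Type w} [AddCommGroup T] [Module k T]
variable {S : TripleSystem k T} (B : S.Coordinates)
variable {W : Type v} [AddCommGroup W] [Module k W] (Q : SymplecticPlane k W)

/-- The homogeneous components of `g(T)`. -/
def degreePart (c : Fin 2 → W) (d : Fin 2 → ℤ) : Submodule k (Q.sp × S.inder × (W ⊗[k] T)) :=
  Submodule.span k (B.fullVec Q c '' {i | fullDegree i = d})

variable {Q} {c : Module.Basis (Fin 2) k W}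
  (hc : ∀ i j, Q.form (c i) (c j) = (planeForm i j : k))

lemma evalList_mem_degreePart {c : Fin 2 → W} {d : Fin 2 → ℤ}
    {l : List (ℤ × (Fin 3 ⊕ (Fin 3 ⊕ Fin 2) ⊕ Fin 2 × (Fin 3 ⊕ Fin 2)))}
    (h : ∀ q ∈ l, fullDegree q.2 = d) : evalList k (B.fullVec Q c) l ∈ B.degreePart Q c d :=
  evalList_mem fun q hq => Submodule.subset_span ⟨q.2, h q hq, rfl⟩

lemma evalList_mem_part (h : S.IsOrthosymplectic) {c : Fin 2 → W} {a : ZMod 2}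
    {l : List (ℤ × (Fin 3 ⊕ (Fin 3 ⊕ Fin 2) ⊕ Fin 2 × (Fin 3 ⊕ Fin 2)))}
    (hl : ∀ q ∈ l, fullParity q.2 = a) :
    evalList k (B.fullVec Q c) l ∈ (S.lieSuperalgebra h Q).part a :=
  evalList_mem fun q hq => hl q hq ▸ B.fullVec_mem h c q.2

variable [CharP k 3]

include B hc

lemma linearIndependent_fullVec : LinearIndependent k (B.fullVec Q c) := by
  rw [← B.coe_fullBasis hc (two_ne_zero_of_charP_three k)]
  exact (B.fullBasis hc _).linearIndependent

lemma span_fullVec : Submodule.span k (Set.range (B.fullVec Q c)) = ⊤ := by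
  rw [← B.coe_fullBasis hc (two_ne_zero_of_charP_three k), Module.Basis.span_eq]

/-- Equality of products of encoded vectors, from the structure constants. -/
lemma mul_evalList_eq (h : S.IsOrthosymplectic)
    {l l' m : List (ℤ × (Fin 3 ⊕ (Fin 3 ⊕ Fin 2) ⊕ Fin 2 × (Fin 3 ⊕ Fin 2)))}
    (hl : VanishesMod3 (mulList fullTable l l' ++ scaleList (-1) m)) :
    (S.lieSuperalgebra h Q).mul (evalList k (B.fullVec Q c) l) (evalList k (B.fullVec Q c) l') =
      evalList k (B.fullVec Q c) m := by
  have := evalList_eq_zero (k := k) (B.fullVec Q c) hl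
  rw [evalList_append, evalList_scaleList, ← mul_evalList (B.mul_fullVec hc h)] at this
  simpa [← sub_eq_add_neg, sub_eq_zero] using this

omit [CharP k 3] in
lemma mul_mem_degreePart (h : S.IsOrthosymplectic) (d d' : Fin 2 → ℤ) :
    ∀ x ∈ B.degreePart Q c d, ∀ y ∈ B.degreePart Q c d',
      (S.lieSuperalgebra h Q).mul x y ∈ B.degreePart Q c (d + d') := by
  intro x hx y hy
  have : Submodule.map₂ (S.lieSuperalgebra h Q).mul (B.degreePart Q c d) (B.degreePart Q c d') ≤
      B.degreePart Q c (d + d') := by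
    rw [degreePart, degreePart, Submodule.map₂_span_span, Submodule.span_le]
    rintro _ ⟨_, ⟨i, rfl, rfl⟩, _, ⟨j, rfl, rfl⟩, rfl⟩
    change (S.lieSuperalgebra h Q).mul _ _ ∈ _
    rw [B.mul_fullVec hc h]
    exact B.evalList_mem_degreePart (fullTable_degree i j)
  exact this (Submodule.apply_mem_map₂ _ hx hy)

lemma iSupIndep_degreePart : iSupIndep (B.degreePart Q c) := by
  intro d
  have hle : ⨆ d', ⨆ (_ : d' ≠ d), B.degreePart Q c d' ≤
      Submodule.span k (B.fullVec Q c '' {i | fullDegree i ≠ d}) :=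
    iSup₂_le fun d' hd' => Submodule.span_mono (Set.image_mono fun i hi hid => hd' (hi.symm.trans hid))
  refine Disjoint.mono_right hle ?_
  refine (B.linearIndependent_fullVec hc).disjoint_span_image ?_
  exact Set.disjoint_left.2 fun i hi hi' => hi' hi

lemma iSup_degreePart : ⨆ d, B.degreePart Q c d = ⊤ := by
  rw [eq_top_iff, ← B.span_fullVec hc, Submodule.span_le]
  rintro _ ⟨i, rfl⟩
  exact Submodule.mem_iSup_of_mem (fullDegree i) (Submodule.subset_span ⟨i, rfl, rfl⟩)

lemma degreePart_nondegenerate (h : S.IsOrthosymplectic) (d : Fin 2 → ℤ) (hd : d ≠ 0) :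
    ∀ x ∈ B.degreePart Q c d,
      (∀ y ∈ B.degreePart Q c (-d), (S.lieSuperalgebra h Q).mul y x = 0) → x = 0 := by
  intro x hx hxy
  by_cases hi : ∃ i, fullDegree i = d
  · obtain ⟨i, rfl⟩ := hi
    have hs : {j | fullDegree j = fullDegree i} = {i} := by
      ext j
      exact ⟨fullDegree_injOn i j hd, fun hj => congrArg fullDegree hj⟩
    rw [degreePart, hs, Set.image_singleton, Submodule.mem_span_singleton] at hx
    obtain ⟨a, rfl⟩ := hx
    obtain ⟨j, hj, l, hl⟩ := exists_opposite i hd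
    have h0 := hxy (B.fullVec Q c j) (Submodule.subset_span ⟨j, hj, rfl⟩)
    rw [map_smul, B.mul_fullVec hc h, evalList_eq_sum, Finset.smul_sum] at h0
    simp only [smul_smul] at h0
    have h1 := Fintype.linearIndependent_iff.1 (B.linearIndependent_fullVec hc) _ h0 l
    have h2 : ((coeffList (fullTable j i) l : ℤ) : k) ≠ 0 := by
      intro h2
      rw [CharP.intCast_eq_zero_iff k 3] at h2
      exact hl (Int.emod_eq_zero_of_dvd (by exact_mod_cast h2))
    rw [(mul_eq_zero.1 h1).resolve_right h2, zero_smul]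
  · have hs : {j | fullDegree j = d} = ∅ :=
      Set.eq_empty_of_forall_notMem fun j hj => hi ⟨j, hj⟩
    rw [degreePart, hs, Set.image_empty, Submodule.span_empty] at hx
    exact hx

lemma linearIndependent_generatorH :
    LinearIndependent k fun i => evalList k (B.fullVec Q c) (generatorH i) := by
  have hv : LinearIndependent k ![B.fullVec Q c (.inl 1), B.fullVec Q c (.inr (.inl (.inl 1)))] := by
    convert (B.linearIndependent_fullVec hc).comp ![.inl 1, .inr (.inl (.inl 1))] (by decide)
      using 1
    funext i
    fin_cases i <;> rfl
  have h := LinearIndependent.pair_iff.1 hv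
  refine Fintype.linearIndependent_iff.2 fun a ha => ?_
  rw [Fin.sum_univ_two] at ha
  -- With $\gamma=\gamma_{0,1}$ of $\mathfrak{sp}(W)$ and $\delta=\mathrm{ad}\,\gamma_{0,1}$, one
  -- has $h_1=\gamma-\delta$ and $h_2=\delta$.
  obtain ⟨h0, h1⟩ := h (a 0) (a 1 - a 0) (by
    rw [← ha]
    simp [generatorH]
    module)
  intro i
  fin_cases i
  · exact h0
  · simpa [h0] using h1

/-- Each root vector is reached from the generators by successive brackets whose structure constants
are nonzero modulo $3$. -/
lemma degreePart_le (h : S.IsOrthosymplectic)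
    (R : (Fin 2 → ℤ) → Submodule k (Q.sp × S.inder × (W ⊗[k] T)))
    (hE : ∀ i, evalList k (B.fullVec Q c) (generatorE i) ∈ R (Pi.single i 1))
    (hF : ∀ i, evalList k (B.fullVec Q c) (generatorF i) ∈ R (-Pi.single i 1))
    (hH : ∀ i, evalList k (B.fullVec Q c) (generatorH i) ∈ R 0)
    (hR : ∀ d d', ∀ x ∈ R d, ∀ y ∈ R d', (S.lieSuperalgebra h Q).mul x y ∈ R (d + d'))
    (d : Fin 2 → ℤ) : B.degreePart Q c d ≤ R d := by
  -- The integer $a$ inverts modulo $3$ the coefficient of the basis vector $l$ in the product of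
  -- $i$ and $j$.
  have step : ∀ i j l, ∀ a : ℤ, VanishesMod3 (scaleList a (fullTable i j) ++ [(-1, l)]) →
      fullDegree i + fullDegree j = fullDegree l → B.fullVec Q c i ∈ R (fullDegree i) →
      B.fullVec Q c j ∈ R (fullDegree j) → B.fullVec Q c l ∈ R (fullDegree l) := by
    intro i j l a hv hd hi hj
    have h0 := evalList_eq_zero (k := k) (B.fullVec Q c) hv
    rw [evalList_append, evalList_scaleList, ← B.mul_fullVec hc h] at h0
    have h1 : B.fullVec Q c l =
        (a : k) • (S.lieSuperalgebra h Q).mul (B.fullVec Q c i) (B.fullVec Q c j) := by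
      simp only [evalList_cons, evalList_nil, Int.cast_neg, Int.cast_one, neg_smul, one_smul,
        add_zero] at h0
      exact (add_neg_eq_zero.1 h0).symm
    rw [h1, ← hd]
    exact Submodule.smul_mem _ _ (hR _ _ _ hi _ hj)
  have e1 : B.fullVec Q c (.inr (.inr (1, .inl 0))) ∈ R (fullDegree (.inr (.inr (1, .inl 0)))) := by
    rw [show fullDegree (.inr (.inr (1, .inl 0))) = Pi.single 0 1 by decide]
    simpa [generatorE] using hE 0
  have e2 : B.fullVec Q c (.inr (.inl (.inr 1))) ∈ R (fullDegree (.inr (.inl (.inr 1)))) := by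
    rw [show fullDegree (.inr (.inl (.inr 1))) = Pi.single 1 1 by decide]
    simpa [generatorE] using hE 1
  have f1 : B.fullVec Q c (.inr (.inr (0, .inl 2))) ∈ R (fullDegree (.inr (.inr (0, .inl 2)))) := by
    rw [show fullDegree (.inr (.inr (0, .inl 2))) = -Pi.single 0 1 by decide]
    simpa [generatorF] using hF 0
  have f2 : B.fullVec Q c (.inr (.inl (.inr 0))) ∈ R (fullDegree (.inr (.inl (.inr 0)))) := by
    rw [show fullDegree (.inr (.inl (.inr 0))) = -Pi.single 1 1 by decide]
    simpa [generatorF] using hF 1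
  have h2 : B.fullVec Q c (.inr (.inl (.inl 1))) ∈ R (fullDegree (.inr (.inl (.inl 1)))) := by
    rw [show fullDegree (.inr (.inl (.inl 1))) = 0 by decide]
    simpa [generatorH] using hH 1
  -- In $h_1+h_2$ the inner derivations cancel and $\gamma_{0,1}\in\mathfrak{sp}(W)$ remains.
  have h1 : B.fullVec Q c (.inl 1) ∈ R (fullDegree (.inl 1)) := by
    rw [show fullDegree (.inl 1) = 0 by decide]
    simpa [generatorH] using add_mem (hH 0) (hH 1)
  have g00 := step _ _ (.inr (.inl (.inl 0))) (-1) (by decide +kernel) (by decide) f2 f2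
  have g11 := step _ _ (.inr (.inl (.inl 2))) (-1) (by decide +kernel) (by decide) e2 e2
  -- Repeated brackets with $e_2$ climb the string $\alpha_1+j\alpha_2$ up to $j=4$; one more
  -- bracket with $e_1$ gives the highest root $2\alpha_1+4\alpha_2$. The negative roots are treated
  -- in the same way.
  have p1 := step _ _ (.inr (.inr (1, .inr 0))) (-1) (by decide +kernel) (by decide) e2 e1
  have p2 := step _ _ (.inr (.inr (1, .inl 1))) 1 (by decide +kernel) (by decide) e2 p1
  have p3 := step _ _ (.inr (.inr (1, .inr 1))) 1 (by decide +kernel) (by decide) e2 p2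
  have p4 := step _ _ (.inr (.inr (1, .inl 2))) 1 (by decide +kernel) (by decide) e2 p3
  have p5 := step _ _ (.inl 2) 1 (by decide +kernel) (by decide) e1 p4
  have n1 := step _ _ (.inr (.inr (0, .inr 1))) 1 (by decide +kernel) (by decide) f2 f1
  have n2 := step _ _ (.inr (.inr (0, .inl 1))) 1 (by decide +kernel) (by decide) f2 n1
  have n3 := step _ _ (.inr (.inr (0, .inr 0))) (-1) (by decide +kernel) (by decide) f2 n2
  have n4 := step _ _ (.inr (.inr (0, .inl 0))) 1 (by decide +kernel) (by decide) f2 n3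
  have n5 := step _ _ (.inl 0) 1 (by decide +kernel) (by decide) f1 n4
  rw [degreePart, Submodule.span_le]
  rintro _ ⟨i, rfl, rfl⟩
  rcases i with i | (i | i) | ⟨a, i | i⟩
  · fin_cases i
    exacts [n5, h1, p5]
  · fin_cases i
    exacts [g00, h2, g11]
  · fin_cases i
    exacts [f2, e2]
  · fin_cases a <;> fin_cases i
    exacts [n4, n2, f1, e1, p2, p4]
  · fin_cases a <;> fin_cases i
    exacts [n3, n1, p1, p3]

theorem isGradedModel (h : S.IsOrthosymplectic) :
    Contragredient.IsGradedModel (br23Matrix k) (fun _ => 1) (S.lieSuperalgebra h Q)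
      (B.degreePart Q c) (fun i => evalList k (B.fullVec Q c) (generatorE i))
      (fun i => evalList k (B.fullVec Q c) (generatorF i))
      (fun i => evalList k (B.fullVec Q c) (generatorH i)) where
  lie := B.isLieSuperalgebra hc h
  e_mem i := B.evalList_mem_part h (by revert i; decide)
  f_mem i := B.evalList_mem_part h (by revert i; decide)
  h_mem i := B.evalList_mem_part h (by revert i; decide)
  mul_hh i j := B.mul_evalList_eq hc h (m := []) (by revert i j; decide +kernel)
  mul_he i j := by
    have hA : br23Matrix k i j = (((![![0, -1], ![-2, 1]] : Fin 2 → Fin 2 → ℤ) i j : ℤ) : k) := by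
      fin_cases i <;> fin_cases j <;> simp [br23Matrix]
    rw [hA, ← evalList_scaleList]
    -- Without `hA`, which involves $k$, the congruence left after reverting $i$ and $j$ concerns
    -- integers only and is decidable.
    clear hA
    exact B.mul_evalList_eq hc h (by revert i j; decide +kernel)
  mul_hf i j := by
    have hA : -br23Matrix k i j =
        (((![![0, 1], ![2, -1]] : Fin 2 → Fin 2 → ℤ) i j : ℤ) : k) := by
      fin_cases i <;> fin_cases j <;> simp [br23Matrix]
    rw [hA, ← evalList_scaleList]
    clear hA
    exact B.mul_evalList_eq hc h (by revert i j; decide +kernel)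
  -- The generators are normalised for this relation:
  -- $[e_1,f_1]=-8\gamma_{0,1}-4\,\mathrm{ad}\,\gamma_{0,1}$, which modulo $3$ is
  -- $\gamma_{0,1}-\mathrm{ad}\,\gamma_{0,1}$, and the sign in $f_2$ makes
  -- $[e_2,f_2]=\mathrm{ad}\,\gamma_{0,1}$.
  mul_ef i j := by
    have hm : (if i = j then evalList k (B.fullVec Q c) (generatorH i) else 0) =
        evalList k (B.fullVec Q c) (if i = j then generatorH i else []) := by
      split_ifs <;> rfl
    rw [hm]
    clear hm
    exact B.mul_evalList_eq hc h (by revert i j; decide +kernel)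
  h_indep := B.linearIndependent_generatorH hc
  gr_indep := B.iSupIndep_degreePart hc
  gr_sup := B.iSup_degreePart hc
  gr_mul := B.mul_mem_degreePart hc h
  e_gr i := B.evalList_mem_degreePart (by revert i; decide)
  f_gr i := B.evalList_mem_degreePart (by revert i; decide)
  h_gr i := B.evalList_mem_degreePart (by revert i; decide)
  generated := B.degreePart_le hc h
  nondegenerate := B.degreePart_nondegenerate hc h

end TripleSystem.Coordinates

end SuperTriple

end

open SuperTriple in
theorem theorem4p10 {k : Type*} [Field k] [CharP k 3]
    {V : Type*} [AddCommGroup V] [Module k V] (P : SymplecticPlane k V)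
    {W : Type*} [AddCommGroup W] [Module k W] (Q : SymplecticPlane k W) :
    ∃ h : (B42.tripleSystem P).IsOrthosymplectic,
      Module.finrank k ((B42.tripleSystem P).part 0) = 3 ∧
      Module.finrank k ((B42.tripleSystem P).part 1) = 2 ∧
      IsLieSuperalgebra ((B42.tripleSystem P).lieSuperalgebra h Q) ∧
      ((B42.tripleSystem P).lieSuperalgebra h Q).IsIsomorphic (br23 k) := by
  obtain ⟨b, hb⟩ := P.exists_symplecticBasis
  obtain ⟨c, hc⟩ := Q.exists_symplecticBasis
  have h := B42.isOrthosymplectic_tripleSystem P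
  exact ⟨h, B42.finrank_part_zero P, B42.finrank_part_one P,
    (B42.coordinates hb).isLieSuperalgebra hc h,
    ((B42.coordinates hb).isGradedModel hc h).isIsomorphic⟩
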